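/- **Theorem (Lower bound for the many-versus-many distinguishing task using pseudorandom states).** For an $(n-1)$-qubit pure state $|\psi\rangle$ put $$\rho_A(|\psi\rangle)=\tfrac12|0\rangle\langle 0|\otimes|\psi\rangle\langle\psi|+\tfrac12|1\rangle\langle 1|\otimes\tfrac{I}{2^{n-1}},\qquad \rho_B(|\psi\rangle)=\tfrac12|1\rangle\langle 1|\otimes|\psi\rangle\langle\psi|+\tfrac12|0\rangle\langle 0|\otimes\tfrac{I}{2^{n-1}}.$$ A function $f:\mathbb N\to\mathbb R$ is negligible if for every $c>0$ one has $f(n)<n^{-c}$ for all sufficiently large $n$. A polynomial-time quantum algorithm is a polynomial-time uniform family of quantum circuits over a fixed universal gate set (Hadamard, $T$, NOT, CNOT, Toffoli). A family of pseudorandom states consists, for each number $m$ of qubits, of a set $\mathcal K_m$, a discrete probability distribution $\mathcal D_m$ on $\mathcal K_m$ and $m$-qubit pure states $\{|\phi_k\rangle\}_{k\in\mathcal K_m}$ such that (i) a polynomial-time quantum algorithm samples $k$ from $\mathcal D_m$ and generates $|\phi_k\rangle$ (up to a negligible total error), and (ii) for every polynomial $t$ and every polynomial-time quantum algorithm $\mathcal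 B$ with output in $\{0,1\}$, the quantity $\big|\Pr_{k\leftarrow\mathcal D_m}[\mathcal B(|\phi_k\rangle^{\otimes t(m)})=1]-\Pr_{|\psi\rangle\leftarrow\mathrm{Haar}}[\mathcal B(|\psi\rangle^{\otimes t(m)})=1]\big|$ is negligible in $m$. A polynomial-time algorithm $\mathcal A$ in the conventional scenario consists, for each $n$, of a learning tree of depth at most polynomial in $n$ (at each node $u$ a single copy of the unknown $n$-qubit state $\rho$ is measured with a rank-one POVM $\{w^u_s|\phi^u_s\rangle\langle\phi^u_s|\}_s$ depending on $u$, the outcome $s$, of probability $w^u_s\langle\phi^u_s|\rho|\phi^u_s\rangle$, determines the next node) and of a binary decision on the leaves, such that running the tree on copies of $\rho$ and then deciding is implemented, for every $\rho$, by a polynomial-time quantum algorithm that receives polynomially many copies of $\rho$. Its output is denoted $\mathcal A(\rho)$. Let $\{|\phi_k\rangle\}$ be a family of pseudorandom states, used on $n-1$ qubits. Then: 1. For every polynomial-time algorithm $\mathcal A$ in the conventional scenario, $$\Big|\Pr_{k\leftarrow\mathcal D_{n-1}}[\mathcal A(\rho_A(|\phi_k\rangle))=1]-\Pr_{k\leftarrow\mathcal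 D_{n-1}}[\mathcal A(\rho_B(|\phi_k\rangle))=1]\Big|$$ is negligible in $n$. 2. In contrast, in the quantum-enhanced scenario there are a constant $\delta>0$, a constant number $c$ of copies, and a polynomial-time quantum algorithm $\mathcal Q$ acting jointly on $c$ copies, such that $\Pr[\mathcal Q(\rho_A(|\psi\rangle)^{\otimes c})=1]-\Pr[\mathcal Q(\rho_B(|\psi\rangle)^{\otimes c})=1]\ge\delta$ for all $n\ge2$ and all $(n-1)$-qubit pure states $|\psi\rangle$ (in particular for all $|\phi_k\rangle$). So the separation persists for efficiently preparable states. -/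

import Mathlib

open scoped Matrix ComplexConjugate ComplexOrder

/-! ## Negligible functions -/

/-- `f` is eventually smaller than every inverse polynomial. -/
def Negligible (f : ℕ → ℝ) : Prop :=
  ∀ c : ℝ, 0 < c → ∀ᶠ n : ℕ in Filter.atTop, f n < (n : ℝ) ^ (-c)

/-! ## States of finitely many qubits -/

/-- The computational basis of `n` qubits. The qubits are numbered from right to left, like binary
digits: qubit `0` is the last tensor factor and qubit `n - 1` is the first one. -/
abbrev Bits (n : ℕ) : Type := Fin n → Bool

/-- Unit vectors of `(ℂ²)^{⊗ n}`. -/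
abbrev PureState (n : ℕ) : Type := Metric.sphere (0 : EuclideanSpace ℂ (Bits n)) 1

/-- The Haar measure on `n`-qubit pure states: the uniform (hence unitarily invariant) probability
measure on the unit sphere. -/
noncomputable def haarState (n : ℕ) : MeasureTheory.Measure (PureState n) :=
  ((MeasureTheory.volume : MeasureTheory.Measure (EuclideanSpace ℂ (Bits n))).toSphere
      Set.univ)⁻¹ •
    (MeasureTheory.volume : MeasureTheory.Measure (EuclideanSpace ℂ (Bits n))).toSphere

/-- The projector `|ψ⟩⟨ψ|`. -/
noncomputable def ketbra {n : ℕ} (ψ : PureState n) : Matrix (Bits n) (Bits n) ℂ :=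
  Matrix.of fun x y => ψ.1 x * conj (ψ.1 y)

/-- The tensor power `ρ^{⊗ t}`. -/
noncomputable def tensorPow {n : ℕ} (t : ℕ) (ρ : Matrix (Bits n) (Bits n) ℂ) :
    Matrix (Fin t → Bits n) (Fin t → Bits n) ℂ :=
  Matrix.of fun x y => ∏ j, ρ (x j) (y j)

/-- The `(m + 1)`-qubit matrix `|b⟩⟨b| ⊗ σ`, where `|b⟩` is the first tensor factor. -/
noncomputable def flagged {m : ℕ} (b : Bool) (σ : Matrix (Bits m) (Bits m) ℂ) :
    Matrix (Bits (m + 1)) (Bits (m + 1)) ℂ :=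
  Matrix.of fun x y =>
    if x (Fin.last m) = b ∧ y (Fin.last m) = b then
      σ (fun c => x c.castSucc) (fun c => y c.castSucc)
    else 0

/-- The maximally mixed state `I / 2^m`. -/
noncomputable def maxMixed (m : ℕ) : Matrix (Bits m) (Bits m) ℂ :=
  ((2 : ℂ) ^ m)⁻¹ • (1 : Matrix (Bits m) (Bits m) ℂ)

/-- `ρ_A(|ψ⟩) = ½ |0⟩⟨0| ⊗ |ψ⟩⟨ψ| + ½ |1⟩⟨1| ⊗ I / 2^m`, on `n = m + 1` qubits. -/
noncomputable def rhoA {m : ℕ} (ψ : PureState m) : Matrix (Bits (m + 1)) (Bits (m + 1)) ℂ :=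
  (1 / 2 : ℂ) • flagged false (ketbra ψ) + (1 / 2 : ℂ) • flagged true (maxMixed m)

/-- `ρ_B(|ψ⟩) = ½ |1⟩⟨1| ⊗ |ψ⟩⟨ψ| + ½ |0⟩⟨0| ⊗ I / 2^m`, on `n = m + 1` qubits. -/
noncomputable def rhoB {m : ℕ} (ψ : PureState m) : Matrix (Bits (m + 1)) (Bits (m + 1)) ℂ :=
  (1 / 2 : ℂ) • flagged true (ketbra ψ) + (1 / 2 : ℂ) • flagged false (maxMixed m)

/-! ## Quantum circuits

The quantum memory is an unbounded array of qubits, all but finitely many of them in the state `|0⟩`.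
A qubit has an address (register, row, column), and a computational basis state is the finite set of
those qubits that are in the state `|1⟩`. -/

/-- Elementary gates: Hadamard, `T = diag(1, e^{iπ/4})`, NOT, controlled NOT and Toffoli (the last
argument is the target). `Q` is the type of names for qubits. -/
inductive Gate (Q : Type) : Type
  | H (q : Q)
  | T (q : Q)
  | X (q : Q)
  | CX (a q : Q)
  | CCX (a b q : Q)

def Gate.map {Q R : Type} (f : Q → R) : Gate Q → Gate R
  | H q => H (f q)
  | T q => T (f q)
  | X q => X (f q)
  | CX a q => CX (f a) (f q)
  | CCX a b q => CCX (f a) (f b) (f q)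

/-- Address of a qubit: register, row, column. -/
abbrev Qubit : Type := ℕ × ℕ × ℕ

/-- Vectors of the quantum memory, in the computational basis. -/
abbrev Ket : Type := Finset Qubit →₀ ℂ

/-- Flip the qubit `q` in the basis state `S`. -/
def flipQubit (q : Qubit) (S : Finset Qubit) : Finset Qubit :=
  if q ∈ S then S.erase q else insert q S

/-- The image of a basis state under a gate. A controlled gate one of whose controls coincides with
its target is read as the identity. -/
noncomputable def Gate.onBasis : Gate Qubit → Finset Qubit → Ket
  | H q, S =>
      Finsupp.single (S.erase q) (((√2 : ℝ) : ℂ)⁻¹) +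
        Finsupp.single (insert q S) (if q ∈ S then -((√2 : ℝ) : ℂ)⁻¹ else ((√2 : ℝ) : ℂ)⁻¹)
  | T q, S =>
      Finsupp.single S (if q ∈ S then Complex.exp (Complex.I * (Real.pi / 4 : ℝ)) else 1)
  | X q, S => Finsupp.single (flipQubit q S) 1
  | CX a q, S => Finsupp.single (if a ≠ q ∧ a ∈ S then flipQubit q S else S) 1
  | CCX a b q, S =>
      Finsupp.single (if a ≠ q ∧ b ≠ q ∧ a ∈ S ∧ b ∈ S then flipQubit q S else S) 1

noncomputable def Gate.apply (g : Gate Qubit) : Ket →ₗ[ℂ] Ket :=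
  Finsupp.linearCombination ℂ g.onBasis

/-- A circuit is a list of gates; the head of the list acts first. -/
abbrev Circuit : Type := List (Gate Qubit)

noncomputable def Circuit.run : Circuit → Ket →ₗ[ℂ] Ket
  | [] => LinearMap.id
  | g :: C => Circuit.run C ∘ₗ g.apply

/-- The basis state in which row `j` of register `0` holds the bit string `x j` (column `c` holds
the qubit number `c`), and all other qubits are `|0⟩`. -/
def inputBasis {t n : ℕ} (x : Fin t → Bits n) : Finset Qubit :=
  (Finset.univ.filter fun p : Fin t × Fin n => x p.1 p.2 = true).image
    fun p => (0, (p.1 : ℕ), (p.2 : ℕ))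

/-- The qubit that is measured at the end of a circuit with binary output. -/
def outQubit : Qubit := (1, 0, 0)

/-- The probability that the circuit `C` outputs `1` on the density matrix `R` of `t` blocks of `n`
qubits, that is `Tr(Π U R U†)`, where `U` is the isometry given by `C` and `Π` projects on the basis
states in which the output qubit is `1`. -/
noncomputable def acceptProb {t n : ℕ} (C : Circuit)
    (R : Matrix (Fin t → Bits n) (Fin t → Bits n) ℂ) : ℝ :=
  (∑ x, ∑ y, R x y *
    (Circuit.run C (Finsupp.single (inputBasis x) 1)).sum fun S a =>
      if outQubit ∈ S then a * conj (Circuit.run C (Finsupp.single (inputBasis y) 1) S)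
      else 0).re

/-! ## Polynomial-time quantum algorithms

A polynomial-time quantum algorithm is a polynomial-time uniform family of circuits. The circuits are
written by a program for a random access machine with the successor and predecessor as its only
arithmetic (so that one step increases the largest number in memory by at most one, and time is
polynomially equivalent to Turing machine time), started on the number of qubits `n` in unary scale:
its running time is bounded by a polynomial in `n`. -/

/-- The classical memory: cells that hold natural numbers. -/
abbrev Mem : Type := ℕ → ℕ

/-- Programs. The operands of an emitted gate are triples (register, row, column), where the register
is a constant, and the row and the column are the contents of two memory cells. -/
inductive Prog : Type
  | inc (i : ℕ)
  | dec (i : ℕ)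
  | copy (i j : ℕ)
  | load (i j : ℕ)
  | store (i j : ℕ)
  | emit (g : Gate (ℕ × ℕ × ℕ))
  | seq (p q : Prog)
  | while (i : ℕ) (p : Prog)

/-- The qubit that an operand of an emitted gate denotes. -/
def Mem.qubit (σ : Mem) (a : ℕ × ℕ × ℕ) : Qubit := (a.1, σ a.2.1, σ a.2.2)

/-- `Exec p σ C σ' τ`: the program `p`, started in the memory `σ`, halts after `τ` steps in the memory
`σ'`, having written the circuit `C`. -/
inductive Exec : Prog → Mem → Circuit → Mem → ℕ → Prop
  | inc (i : ℕ) (σ : Mem) : Exec (.inc i) σ [] (Function.update σ i (σ i + 1)) 1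
  | dec (i : ℕ) (σ : Mem) : Exec (.dec i) σ [] (Function.update σ i (σ i - 1)) 1
  | copy (i j : ℕ) (σ : Mem) : Exec (.copy i j) σ [] (Function.update σ i (σ j)) 1
  | load (i j : ℕ) (σ : Mem) : Exec (.load i j) σ [] (Function.update σ i (σ (σ j))) 1
  | store (i j : ℕ) (σ : Mem) : Exec (.store i j) σ [] (Function.update σ (σ i) (σ j)) 1
  | emit (g : Gate (ℕ × ℕ × ℕ)) (σ : Mem) : Exec (.emit g) σ [g.map σ.qubit] σ 1
  | seq {p q : Prog} {σ₁ σ₂ σ₃ : Mem} {C₁ C₂ : Circuit} {τ₁ τ₂ : ℕ} :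
      Exec p σ₁ C₁ σ₂ τ₁ → Exec q σ₂ C₂ σ₃ τ₂ → Exec (.seq p q) σ₁ (C₁ ++ C₂) σ₃ (τ₁ + τ₂)
  | while_done {i : ℕ} {p : Prog} {σ : Mem} : σ i = 0 → Exec (.while i p) σ [] σ 1
  | while_step {i : ℕ} {p : Prog} {σ₁ σ₂ σ₃ : Mem} {C₁ C₂ : Circuit} {τ₁ τ₂ : ℕ} :
      σ₁ i ≠ 0 → Exec p σ₁ C₁ σ₂ τ₁ → Exec (.while i p) σ₂ C₂ σ₃ τ₂ →
        Exec (.while i p) σ₁ (C₁ ++ C₂) σ₃ (1 + τ₁ + τ₂)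

/-- The initial memory: cell `0` holds the number `n` of qubits of one input state, cell `1` holds the
number `t` of copies. -/
def initMem (n t : ℕ) : Mem := fun i => if i = 0 then n else if i = 1 then t else 0

/-- The circuits `C n`, with `t n` copies of an `n`-qubit state as input, form a polynomial-time
quantum algorithm. -/
def IsPolyTime (t : ℕ → ℕ) (C : ℕ → Circuit) : Prop :=
  ∃ (p : Prog) (P : Polynomial ℕ), ∀ n, ∃ (σ : Mem) (τ : ℕ),
    Exec p (initMem n (t n)) (C n) σ τ ∧ τ ≤ P.eval n

/-! ## Pseudorandom states -/

/-- The content of the key register (register `1`). -/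
def keyPart (S : Finset Qubit) : Finset Qubit := S.filter fun q => q.1 = 1

/-- The content of all qubits except the `n` qubits of the output state (row `0` of register `0`). -/
def restPart (n : ℕ) (S : Finset Qubit) : Finset Qubit :=
  S.filter fun q => ¬ (q.1 = 0 ∧ q.2.1 = 0 ∧ q.2.2 < n)

/-- In the memory state `v`, the joint probability of reading `κ` when the key register is measured and
of then finding the `n` output qubits in the state `|ψ⟩`. It is a sum, over the basis states `R` of all
other qubits with key `κ`, of `|(⟨ψ| ⊗ ⟨R|) v|²`. -/
noncomputable def keyStateProb {n : ℕ} (v : Ket) (κ : Finset Qubit) (ψ : PureState n) : ℝ :=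
  ∑ R ∈ (v.support.image (restPart n)).filter fun R => keyPart R = κ,
    ‖∑ x : Bits n, conj (ψ.1 x) * v (R ∪ inputBasis fun _ : Fin 1 => x)‖ ^ 2

/-- The states `φ n k` on `n` qubits, with keys `k` drawn from `D n`, are efficiently generated: a
polynomial-time quantum algorithm without input samples `k` from `D n`, writes it (in some encoding) in
the key register and produces `φ n k`. As is usual with a finite gate set, an error that is negligible
in total is allowed; the algorithm is exact if and only if all the joint probabilities below are equal to
`D n k`. -/
def EfficientlyGenerated {K : ℕ → Type*} (D : ∀ n, PMF (K n)) (φ : ∀ n, K n → PureState n) : Prop :=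
  ∃ (G : ℕ → Circuit) (enc : ∀ n, K n → Finset Qubit),
    IsPolyTime (fun _ => 0) G ∧ (∀ n, Function.Injective (enc n)) ∧
    Negligible fun n => ∑' k,
      |(D n k).toReal -
        keyStateProb (Circuit.run (G n) (Finsupp.single ∅ 1)) (enc n k) (φ n k)|

/-- Pseudorandom quantum states: efficiently generated, and polynomially many copies are
computationally indistinguishable from copies of a Haar random state. -/
structure IsPseudorandom {K : ℕ → Type*} (D : ∀ n, PMF (K n)) (φ : ∀ n, K n → PureState n) :
    Prop where
  generated : EfficientlyGenerated D φ
  indistinguishable : ∀ (t : Polynomial ℕ) (C : ℕ → Circuit), IsPolyTime (fun n => t.eval n) C →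
    Negligible fun n =>
      |(∑' k, (D n k).toReal * acceptProb (C n) (tensorPow (t.eval n) (ketbra (φ n k)))) -
        ∫ ψ, acceptProb (C n) (tensorPow (t.eval n) (ketbra ψ)) ∂(haarState n)|

/-! ## Learning trees and the conventional scenario -/

/-- A rank-one POVM `{w_s |φ_s⟩⟨φ_s|}` on `n` qubits with outcomes `s ∈ {0, …, r - 1}`. -/
structure RankOnePOVM (n r : ℕ) where
  weight : Fin r → ℝ
  vec : Fin r → PureState n
  weight_nonneg : ∀ s, 0 ≤ weight s
  sum_eq_one : ∑ s, (weight s : ℂ) • ketbra (vec s) = 1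

/-- The probability `w_s ⟨φ_s| ρ |φ_s⟩` of the outcome `s`. -/
noncomputable def RankOnePOVM.prob {n r : ℕ} (M : RankOnePOVM n r)
    (ρ : Matrix (Bits n) (Bits n) ℂ) (s : Fin r) : ℝ :=
  M.weight s * (∑ x, ∑ y, conj ((M.vec s).1 x) * ρ x y * (M.vec s).1 y).re

/-- A learning tree for `n`-qubit states in the conventional scenario. A node is the list of the
outcomes obtained so far. At each node one copy of the unknown state is measured with a POVM that depends
on the node. (Outcomes of weight zero never occur, so a common number `r` of outcomes is no restriction;
the POVMs at lists of length `≥ depth` play no role.) -/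
structure LearningTree (n : ℕ) where
  depth : ℕ
  r : ℕ
  povm : List (Fin r) → RankOnePOVM n r

/-- The leaves: complete transcripts of the measurement outcomes. -/
abbrev LearningTree.Leaf {n : ℕ} (𝒯 : LearningTree n) : Type := Fin 𝒯.depth → Fin 𝒯.r

/-- The probability `p_ρ(ℓ)` to arrive at the leaf `ℓ` when the unknown state is `ρ`. -/
noncomputable def LearningTree.leafProb {n : ℕ} (𝒯 : LearningTree n)
    (ρ : Matrix (Bits n) (Bits n) ℂ) (ℓ : 𝒯.Leaf) : ℝ :=
  ∏ i : Fin 𝒯.depth, (𝒯.povm ((List.ofFn ℓ).take i)).prob ρ (ℓ i)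

/-- A polynomial-time algorithm in the conventional scenario: for each `n` a learning tree and a binary
decision on its leaves such that running the tree on copies of `ρ` and then deciding is implemented by a
polynomial-time quantum algorithm. The algorithm is handed a polynomial number of copies, at least as
many as the tree consumes, and has the same output distribution as the tree with its decision, for every
state `ρ`. -/
structure ConventionalAlgorithm where
  tree : ∀ n, LearningTree n
  decision : ∀ n, (tree n).Leaf → Bool
  copies : Polynomial ℕ
  depth_le : ∀ n, (tree n).depth ≤ copies.eval n
  circuit : ℕ → Circuit
  polyTime : IsPolyTime (fun n => copies.eval n) circuit
  implements : ∀ n (ρ : Matrix (Bits n) (Bits n) ℂ), ρ.PosSemidef → ρ.trace = 1 →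
    acceptProb (circuit n) (tensorPow (copies.eval n) ρ) =
      ∑ ℓ : (tree n).Leaf, if decision n ℓ = true then (tree n).leafProb ρ ℓ else 0

/-- `Pr[𝒜(ρ) = 1]`. -/
noncomputable def ConventionalAlgorithm.prob (A : ConventionalAlgorithm) {n : ℕ}
    (ρ : Matrix (Bits n) (Bits n) ℂ) : ℝ :=
  ∑ ℓ : (A.tree n).Leaf, if A.decision n ℓ = true then (A.tree n).leafProb ρ ℓ else 0

/-! Part 1 compares both flagged states with the maximally mixed state on `m + 1` qubits. At a leaf
of a tree of depth `T`, the probability under `flagState b ψ` is a product of factors `w/2 * (‖⟨v_b,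
ψ⟩‖² + ‖v_{!b}‖² / 2^m)`, where `v_b` and `v_{!b}` are the two flag slices of a unit vector. If `ψ`
is Haar random, the moment bound `𝔼 ∏ ‖⟨b_i, ψ⟩‖² ≥ ∏ ‖b_i‖² / (2^m + T)` makes the average at least
`∏ w/2 * 1/(2^m + T)`. The maximally mixed state gives `∏ w/2 * 1/2^m`, so each likelihood ratio is
at least `1 - T²/2^m` (`LearningTree.leafProb_maxMixed_le`). Such a one-sided bound at every leaf
bounds the distinguishing advantage by `T²/2^m`, for either value of `b`.

The moment bound comes from Gaussian integrals. On holomorphic polynomials with weight `exp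
(-‖z‖²)`, multiplication by `⟨a, z⟩` is adjoint to the derivative along `a`. The commutation
relation gives `‖⟨a,·⟩ f‖² = ‖a‖² ‖f‖² + ‖∂_a f‖²`, and the last term is dropped. Polar coordinates
carry the inequality to the sphere.

Haar states are exchanged for pseudorandom ones by a reduction: a circuit that receives copies of
`ψ` turns each into a copy of `flagState b ψ`, using Hadamard gates as coins and leaving garbage
that decoheres, and then runs the circuit of the conventional algorithm
(`ConventionalAlgorithm.exists_simulates`). Pseudorandomness applies to the combined circuit, and
the triangle inequality through the maximally mixed state finishes Part 1.

Part 2 is a swap test on the unflagged qubits of two copies, accepting if it fails and the flag of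
the first copy is `1`. That flag selects `I / 2^m` under `rhoA` and `ψ` under `rhoB`, and the mixed
state fails the test more often (`acceptProb_swapTest_sub`). -/

/-! ### Gaussian integrals of holomorphic polynomials -/

section Gaussian

open MeasureTheory

/-- Polynomial functions on `ℂ^ι`. -/
inductive PolyFun {ι : Type*} [Fintype ι] : (EuclideanSpace ℂ ι → ℂ) → Prop
  | const (c : ℂ) : PolyFun fun _ => c
  | lin (b : EuclideanSpace ℂ ι) : PolyFun fun z => inner ℂ b z
  | add {f g : EuclideanSpace ℂ ι → ℂ} : PolyFun f → PolyFun g → PolyFun fun z => f z + g z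
  | mul {f g : EuclideanSpace ℂ ι → ℂ} : PolyFun f → PolyFun g → PolyFun fun z => f z * g z

/-- Continuous functions that grow at most polynomially. -/
def PolyGrowth {ι : Type*} [Fintype ι] (f : EuclideanSpace ℂ ι → ℂ) : Prop :=
  Continuous f ∧ ∃ (C : ℝ) (N : ℕ), 0 ≤ C ∧ ∀ z, ‖f z‖ ≤ C * (1 + ‖z‖) ^ N

/-- The Gaussian weight `exp (-‖z‖²)`. -/
noncomputable def gaussWeight {ι : Type*} [Fintype ι] (z : EuclideanSpace ℂ ι) : ℝ :=
  Real.exp (-‖z‖ ^ 2)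

variable {ι : Type*} [Fintype ι] {f g : EuclideanSpace ℂ ι → ℂ}

lemma PolyGrowth.mul (hf : PolyGrowth f) (hg : PolyGrowth g) : PolyGrowth fun z => f z * g z := by
  obtain ⟨hf, C, N, hC, hfb⟩ := hf
  obtain ⟨hg, C', N', hC', hgb⟩ := hg
  refine ⟨hf.mul hg, C * C', N + N', by positivity, fun z => ?_⟩
  rw [norm_mul, pow_add]
  calc ‖f z‖ * ‖g z‖ ≤ (C * (1 + ‖z‖) ^ N) * (C' * (1 + ‖z‖) ^ N') := by
        gcongr
        exacts [hfb z, hgb z]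
    _ = _ := by ring

lemma PolyGrowth.add (hf : PolyGrowth f) (hg : PolyGrowth g) : PolyGrowth fun z => f z + g z := by
  obtain ⟨hf, C, N, hC, hfb⟩ := hf
  obtain ⟨hg, C', N', hC', hgb⟩ := hg
  refine ⟨hf.add hg, C + C', N + N', by positivity, fun z => (norm_add_le _ _).trans ?_⟩
  have h1 : (1 : ℝ) ≤ 1 + ‖z‖ := by linarith [norm_nonneg z]
  calc ‖f z‖ + ‖g z‖ ≤ C * (1 + ‖z‖) ^ N + C' * (1 + ‖z‖) ^ N' := add_le_add (hfb z) (hgb z)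
    _ ≤ C * (1 + ‖z‖) ^ (N + N') + C' * (1 + ‖z‖) ^ (N + N') := by
        gcongr <;> omega
    _ = _ := by ring

lemma PolyGrowth.conj (hf : PolyGrowth f) : PolyGrowth fun z => conj (f z) := by
  obtain ⟨hf, C, N, hC, hfb⟩ := hf
  exact ⟨Complex.continuous_conj.comp hf, C, N, hC, fun z => by simpa using hfb z⟩

lemma PolyGrowth.const (c : ℂ) : PolyGrowth fun _ : EuclideanSpace ℂ ι => c :=
  ⟨continuous_const, ‖c‖, 0, norm_nonneg _, fun z => by simp⟩

lemma PolyFun.polyGrowth (hf : PolyFun f) : PolyGrowth f := by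
  induction hf with
  | const c => exact .const c
  | lin b =>
    refine ⟨by fun_prop, ‖b‖, 1, norm_nonneg _, fun z => (norm_inner_le_norm b z).trans ?_⟩
    gcongr
    linarith
  | add _ _ hf hg => exact hf.add hg
  | mul _ _ hf hg => exact hf.mul hg

lemma PolyFun.prod {κ : Type*} (s : Finset κ) (b : κ → EuclideanSpace ℂ ι) :
    PolyFun fun z => ∏ i ∈ s, inner ℂ (b i) z := by
  classical
  induction s using Finset.induction_on with
  | empty => simpa using PolyFun.const 1
  | insert i s hi ih => simpa only [Finset.prod_insert hi] using (PolyFun.lin (b i)).mul ih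

/-- The inner product is linear in its second argument, so `PolyFun` generates only holomorphic
polynomials, and complex derivatives stay in the class. -/
lemma PolyFun.exists_hasLineDerivAt (hf : PolyFun f) (a : EuclideanSpace ℂ ι) :
    ∃ f', PolyFun f' ∧ ∀ z, HasLineDerivAt ℂ f (f' z) z a := by
  induction hf with
  | const c => exact ⟨_, .const 0, fun z => hasDerivAt_const _ _⟩
  | lin b =>
    refine ⟨_, .const (inner ℂ b a), fun z => ?_⟩
    have : HasFDerivAt (fun z : EuclideanSpace ℂ ι => inner ℂ b z) (innerSL ℂ b) z :=
      (innerSL ℂ b).hasFDerivAt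
    simpa using this.hasLineDerivAt a
  | add _ _ hf hg =>
    obtain ⟨f', hf', hf⟩ := hf
    obtain ⟨g', hg', hg⟩ := hg
    exact ⟨_, hf'.add hg', fun z => HasDerivAt.add (hf z) (hg z)⟩
  | mul hf₀ hg₀ hf hg =>
    obtain ⟨f', hf', hf⟩ := hf
    obtain ⟨g', hg', hg⟩ := hg
    refine ⟨_, (hf'.mul hg₀).add (hf₀.mul hg'), fun z => ?_⟩
    have := HasDerivAt.mul (hf z) (hg z)
    simp only [zero_smul, add_zero] at this
    exact this

/-- Domination by a multiple of `(1 + ‖z‖)^(-M)` with `M` one more than the real dimension. The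
decay comes from `exp (-r²) ≤ e² exp (-(1 + r))`, that is `r² - r + 1 ≥ 0`, and from `x^k exp (-x) ≤
k!`. -/
lemma integrable_pow_mul_gaussWeight (N : ℕ) :
    Integrable fun z : EuclideanSpace ℂ ι => (1 + ‖z‖) ^ N * gaussWeight z := by
  set M : ℕ := Module.finrank ℝ (EuclideanSpace ℂ ι) + 1 with hM
  have h := integrable_one_add_norm (E := EuclideanSpace ℂ ι) (μ := volume) (r := (M : ℝ))
    (by rw [hM]; push_cast; linarith)
  refine (h.const_mul (Real.exp 2 * (N + M).factorial)).mono' ?_ (.of_forall fun z => ?_)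
  · unfold gaussWeight
    exact Continuous.aestronglyMeasurable (by fun_prop)
  · have h1 : 0 < 1 + ‖z‖ := by positivity
    rw [Real.norm_of_nonneg (by unfold gaussWeight; positivity), Real.rpow_neg h1.le,
      Real.rpow_natCast]
    have h2 : gaussWeight z ≤ Real.exp 2 * Real.exp (-(1 + ‖z‖)) := by
      rw [gaussWeight, ← Real.exp_add]
      refine Real.exp_le_exp.2 ?_
      nlinarith [sq_nonneg (‖z‖ - 1), norm_nonneg z]
    have h3 : (1 + ‖z‖) ^ (N + M) * Real.exp (-(1 + ‖z‖)) ≤ (N + M).factorial := by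
      have := Real.pow_div_factorial_le_exp (1 + ‖z‖) h1.le (N + M)
      rw [div_le_iff₀ (by positivity)] at this
      rw [Real.exp_neg, ← div_eq_mul_inv, div_le_iff₀ (Real.exp_pos _)]
      linarith
    rw [← div_eq_mul_inv, le_div_iff₀ (by positivity)]
    calc (1 + ‖z‖) ^ N * gaussWeight z * (1 + ‖z‖) ^ M
        ≤ (1 + ‖z‖) ^ N * (Real.exp 2 * Real.exp (-(1 + ‖z‖))) * (1 + ‖z‖) ^ M := by gcongr
      _ = Real.exp 2 * ((1 + ‖z‖) ^ (N + M) * Real.exp (-(1 + ‖z‖))) := by rw [pow_add]; ring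
      _ ≤ _ := by gcongr

lemma PolyGrowth.integrable (hf : PolyGrowth f) :
    Integrable fun z => f z * (gaussWeight z : ℂ) := by
  obtain ⟨hf, C, N, hC, hfb⟩ := hf
  refine ((integrable_pow_mul_gaussWeight N).const_mul C).mono' ?_ (.of_forall fun z => ?_)
  · unfold gaussWeight
    exact Continuous.aestronglyMeasurable (by fun_prop)
  · have h0 : 0 ≤ gaussWeight z := (Real.exp_pos _).le
    rw [norm_mul, Complex.norm_of_nonneg h0, ← mul_assoc]
    gcongr
    exact hfb z

lemma hasLineDerivAt_gaussWeight (z v : EuclideanSpace ℂ ι) :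
    HasLineDerivAt ℝ (fun z => (gaussWeight z : ℂ))
      ((-2 * (inner ℂ v z).re * gaussWeight z : ℝ) : ℂ) z v := by
  have h1 (t : ℝ) : ‖z + t • v‖ ^ 2 = ‖z‖ ^ 2 + 2 * (t * (inner ℂ v z).re) + t ^ 2 * ‖v‖ ^ 2 := by
    have := norm_add_sq (𝕜 := ℂ) (z) ((t : ℂ) • v)
    rw [inner_smul_right, norm_smul, ← inner_conj_symm z v] at this
    have h2 : (t : ℂ) • v = t • v := by
      ext i; simp
    rw [h2] at this
    rw [this]
    simp [mul_pow]
    exact Or.inl (by rw [← inner_conj_symm, Complex.conj_re])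
  have h2 : HasDerivAt (fun t : ℝ => gaussWeight (z + t • v))
      (-2 * (inner ℂ v z).re * gaussWeight z) 0 := by
    unfold gaussWeight
    simp_rw [h1]
    have h3 : HasDerivAt (fun t : ℝ =>
        -(‖z‖ ^ 2 + 2 * (t * (inner ℂ v z).re) + t ^ 2 * ‖v‖ ^ 2))
        (-(2 * (inner ℂ v z).re)) 0 := by
      have ha := ((hasDerivAt_id (0 : ℝ)).mul_const (inner ℂ v z).re).const_mul 2
      have hb := (hasDerivAt_pow 2 (0 : ℝ)).mul_const (‖v‖ ^ 2)
      exact ((ha.const_add (‖z‖ ^ 2)).add hb).neg.congr_deriv (by simp)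
    refine h3.exp.congr_deriv ?_
    simp
    ring
  exact h2.ofReal_comp

/-- Integration by parts against the Gaussian weight. -/
lemma integral_mul_re_inner_gaussWeight {F F' : EuclideanSpace ℂ ι → ℂ}
    (v : EuclideanSpace ℂ ι) (hF : PolyGrowth F) (hF' : PolyGrowth F')
    (h : ∀ z, HasLineDerivAt ℝ F (F' z) z v) :
    ∫ z, F z * (2 * ((inner ℂ v z).re : ℂ)) * gaussWeight z = ∫ z, F' z * gaussWeight z := by
  have hre : PolyGrowth fun z : EuclideanSpace ℂ ι => -(2 * ((inner ℂ v z).re : ℂ)) := by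
    have h1 := (PolyFun.lin v).polyGrowth
    have h2 := (PolyGrowth.const (-1)).mul (h1.add h1.conj)
    convert h2 using 2 with z
    rw [Complex.add_conj]
    push_cast
    ring
  have := integral_bilinear_hasLineDerivAt_right_eq_neg_left_of_integrable
    (μ := (volume : Measure (EuclideanSpace ℂ ι))) (B := ContinuousLinearMap.mul ℝ ℂ)
    (f := F) (f' := F') (g := fun z => (gaussWeight z : ℂ))
    (g' := fun z => ((-2 * (inner ℂ v z).re * gaussWeight z : ℝ) : ℂ)) (v := v)
    (by simpa using hF'.integrable) (by
      refine (hF.mul hre).integrable.congr (.of_forall fun z => ?_)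
      simp
      ring) (by simpa using hF.integrable) (fun z _ => h z)
    (fun z _ => hasLineDerivAt_gaussWeight z v)
  simp only [ContinuousLinearMap.mul_apply'] at this
  rw [← neg_inj, ← this, ← integral_neg]
  congr 1
  ext z
  push_cast
  ring

omit [Fintype ι] in
lemma HasLineDerivAt.real_of_complex {f' : ℂ} {z a : EuclideanSpace ℂ ι}
    (h : HasLineDerivAt ℂ f f' z a) (c : ℂ) : HasLineDerivAt ℝ f (c * f') z (c • a) := by
  have h1 : HasDerivAt (fun t : ℂ => f (z + t • a)) f' (((0 : ℝ) : ℂ) * c) := by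
    simpa [HasLineDerivAt] using h
  have h3 : HasDerivAt (fun t : ℝ => (t : ℂ) * c) c 0 := by
    simpa using (hasDerivAt_id (0 : ℝ)).ofReal_comp.mul_const c
  have h2 := HasDerivAt.comp (0 : ℝ) (h₂ := fun t : ℂ => f (z + t • a))
    (h := fun t : ℝ => (t : ℂ) * c) h1 h3
  rw [mul_comm] at h2
  refine h2.congr_of_eventuallyEq (.of_forall fun t => ?_)
  simp only [Function.comp]
  congr 2
  ext i
  simp
  ring

/-- Multiplication by `⟨a, z⟩` is adjoint to differentiation in the direction `a`. -/
lemma integral_inner_mul_conj_gaussWeight {P P' Q Q' : EuclideanSpace ℂ ι → ℂ}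
    (a : EuclideanSpace ℂ ι) (hP : PolyFun P) (hP' : PolyFun P') (hQ : PolyFun Q) (hQ' : PolyFun Q')
    (hPd : ∀ z, HasLineDerivAt ℂ P (P' z) z a) (hQd : ∀ z, HasLineDerivAt ℂ Q (Q' z) z a) :
    ∫ z, inner ℂ a z * P z * conj (Q z) * gaussWeight z =
      ∫ z, P z * conj (Q' z) * gaussWeight z := by
  have hF := hP.polyGrowth.mul hQ.polyGrowth.conj
  have hF₁ := hP'.polyGrowth.mul hQ.polyGrowth.conj
  have hF₂ := hP.polyGrowth.mul hQ'.polyGrowth.conj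
  have key (c : ℂ) := integral_mul_re_inner_gaussWeight (c • a) hF
    (((PolyGrowth.const c).mul hF₁).add ((PolyGrowth.const (conj c)).mul hF₂)) (fun z => by
      have h1 := (hPd z).real_of_complex c
      have h2 := (hQd z).real_of_complex c
      have h3 : HasLineDerivAt ℝ (fun z => conj (Q z)) (conj (c * Q' z)) z (c • a) :=
        HasDerivAt.star h2
      have h4 := HasDerivAt.mul h1 h3
      simp only [zero_smul, add_zero] at h4
      refine (h4.congr_deriv ?_)
      simp only [map_mul]
      ring)
  -- Add the identity for `c = 1` to `I` times the one for `c = I`. The left factors combine to `2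
  -- ⟨a, z⟩`, the terms with `P'` cancel because `1 + I² = 0`, and those with `conj Q'` double
  -- because `1 + I * conj I = 2`.
  have k1 := key 1
  have k2 := key Complex.I
  have hL := (PolyFun.lin a).polyGrowth
  have hre : PolyGrowth fun z : EuclideanSpace ℂ ι => (2 * ((inner ℂ a z).re : ℂ)) := by
    convert hL.add hL.conj using 2 with z
    rw [Complex.add_conj]
    push_cast
    ring
  have him : PolyGrowth fun z : EuclideanSpace ℂ ι => (2 * ((inner ℂ a z).im : ℂ)) := by
    convert ((PolyGrowth.const (-Complex.I)).mul hL).add ((PolyGrowth.const Complex.I).mul hL.conj)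
      using 2 with z
    have := Complex.sub_conj (inner ℂ a z)
    push_cast at this
    linear_combination Complex.I * this + (2 * ((inner ℂ a z).im : ℂ)) * Complex.I_sq
  have hinner (z : EuclideanSpace ℂ ι) : (inner ℂ (Complex.I • a) z).re = (inner ℂ a z).im := by
    simp
  simp only [hinner, one_smul] at k1 k2
  have hA := (hF.mul hre).integrable
  have hB := (hF.mul him).integrable
  have hA' := (((PolyGrowth.const 1).mul hF₁).add
    ((PolyGrowth.const (conj 1)).mul hF₂)).integrable
  have hB' := (((PolyGrowth.const Complex.I).mul hF₁).add
    ((PolyGrowth.const (conj Complex.I)).mul hF₂)).integrable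
  have k3 := integral_add hA (hB.const_mul Complex.I)
  have k4 := integral_add hA' (hB'.const_mul Complex.I)
  rw [integral_const_mul, k1, k2, ← integral_const_mul, ← integral_add hA'
    (hB'.const_mul Complex.I)] at k3
  refine mul_left_cancel₀ (two_ne_zero (α := ℂ)) ?_
  rw [← integral_const_mul, ← integral_const_mul]
  refine Eq.trans (integral_congr_ae (.of_forall fun z => ?_))
    (k3.trans (integral_congr_ae (.of_forall fun z => ?_)))
  · dsimp only
    conv_lhs => rw [← Complex.re_add_im (inner ℂ a z)]
    ring
  · simp only [Complex.conj_I, map_one]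
    linear_combination (P' z * conj (Q z) - P z * conj (Q' z)) * (gaussWeight z : ℂ) *
      Complex.I_sq

/-- Creation and annihilation operators: moving `⟨a, z⟩` across twice and using `∂_a (⟨a, z⟩ f) =
‖a‖² f + ⟨a, z⟩ ∂_a f` shows that the two sides differ by `∫ ‖∂_a f‖² exp (-‖z‖²) ≥ 0`. -/
lemma integral_normSq_inner_mul_ge (a : EuclideanSpace ℂ ι) (hf : PolyFun f) :
    ‖a‖ ^ 2 * ∫ z, ‖f z‖ ^ 2 * gaussWeight z ≤
      ∫ z, ‖(inner ℂ a z : ℂ)‖ ^ 2 * ‖f z‖ ^ 2 * gaussWeight z := by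
  obtain ⟨f', hf', hfd⟩ := hf.exists_hasLineDerivAt a
  obtain ⟨f'', hf'', hfd'⟩ := hf'.exists_hasLineDerivAt a
  have hL := PolyFun.lin a
  have hLd (z : EuclideanSpace ℂ ι) : HasLineDerivAt ℂ (fun z => (inner ℂ a z : ℂ) * f z)
      (inner ℂ a a * f z + inner ℂ a z * f' z) z a := by
    have h1 : HasFDerivAt (fun z : EuclideanSpace ℂ ι => inner ℂ a z) (innerSL ℂ a) z :=
      (innerSL ℂ a).hasFDerivAt
    have := HasDerivAt.mul (h1.hasLineDerivAt a) (hfd z)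
    simp only [zero_smul, add_zero] at this
    exact this
  have k1 := integral_inner_mul_conj_gaussWeight a hf hf' (hL.mul hf)
    (((PolyFun.const _).mul hf).add (hL.mul hf')) hfd hLd
  have k2 := integral_inner_mul_conj_gaussWeight a hf' hf'' hf hf' hfd' hfd
  have hsq (w : ℂ) : w * conj w = ((‖w‖ ^ 2 : ℝ) : ℂ) := by
    rw [Complex.mul_conj, Complex.normSq_eq_norm_sq]
  have e1 : ∫ z, (inner ℂ a z : ℂ) * f z * conj ((inner ℂ a z : ℂ) * f z) * gaussWeight z =
      ((∫ z, ‖(inner ℂ a z : ℂ)‖ ^ 2 * ‖f z‖ ^ 2 * gaussWeight z : ℝ) : ℂ) := by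
    rw [← integral_complex_ofReal]
    congr 1
    ext z
    rw [hsq, norm_mul]
    push_cast
    ring
  have e2 : ∫ z, f' z * conj (f' z) * gaussWeight z =
      ((∫ z, ‖f' z‖ ^ 2 * gaussWeight z : ℝ) : ℂ) := by
    rw [← integral_complex_ofReal]
    congr 1
    ext z
    rw [hsq]
    push_cast
    ring
  have e3 : ∫ z, f z * conj (inner ℂ a a * f z + inner ℂ a z * f' z) * gaussWeight z =
      ((‖a‖ ^ 2 * ∫ z, ‖f z‖ ^ 2 * gaussWeight z : ℝ) : ℂ) +
        conj (∫ z, inner ℂ a z * f' z * conj (f z) * gaussWeight z) := by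
    have i1 := ((PolyGrowth.const (‖a‖ ^ 2 : ℂ)).mul
      (hf.polyGrowth.mul hf.polyGrowth.conj)).integrable
    have i2 := ((hL.polyGrowth.mul hf'.polyGrowth).mul hf.polyGrowth.conj).conj.integrable
    rw [← integral_conj, Complex.ofReal_mul, ← integral_complex_ofReal, ← integral_const_mul]
    refine Eq.trans (integral_congr_ae (.of_forall fun z => ?_))
      ((integral_add i1 i2).trans ?_)
    · simp only [map_add, map_mul, inner_self_eq_norm_sq_to_K, Complex.conj_conj, map_pow,
        Complex.conj_ofReal, Complex.coe_algebraMap]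
      ring
    · congr 2
      · ext z
        rw [hsq]
        push_cast
        ring
      · ext z
        simp
  rw [e1, e3, k2, e2, Complex.conj_ofReal, ← Complex.ofReal_add] at k1
  have := Complex.ofReal_injective k1
  rw [this]
  refine le_add_of_nonneg_right (integral_nonneg fun z => ?_)
  unfold gaussWeight
  positivity

end Gaussian

/-! ### Lower bounds for moments of Haar random states -/

section Sphere

open MeasureTheory

variable {ι : Type*} [Fintype ι]

/-- Polar coordinates for the Gaussian integral of a function that is homogeneous of degree `k`. -/
lemma integral_homogeneous_mul_gaussWeight [Nonempty ι] {F : EuclideanSpace ℂ ι → ℝ} (k : ℕ)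
    (hF : ∀ (r : ℝ) z, F (r • z) = r ^ k * F z) :
    ∫ z, F z * gaussWeight z =
      (∫ ψ : Metric.sphere (0 : EuclideanSpace ℂ ι) 1, F ψ.1
        ∂(volume : Measure (EuclideanSpace ℂ ι)).toSphere) *
      (Real.Gamma (Fintype.card ι + k / 2) / 2) := by
  have hdim : Module.finrank ℝ (EuclideanSpace ℂ ι) = 2 * Fintype.card ι := by
    rw [finrank_real_of_complex, finrank_euclideanSpace]
  have hpos : 0 < Fintype.card ι := Fintype.card_pos
  set G : EuclideanSpace ℂ ι → ℝ := fun z => F z * gaussWeight z with hG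
  calc ∫ z, G z = ∫ x : ({(0)}ᶜ : Set (EuclideanSpace ℂ ι)), G x.1 ∂(volume.comap Subtype.val) := by
        rw [integral_subtype_comap (measurableSet_singleton _).compl G, restrict_compl_singleton]
    _ = ∫ x, F x.1.1 * (x.2.1 ^ k * Real.exp (-x.2.1 ^ 2))
          ∂(volume : Measure (EuclideanSpace ℂ ι)).toSphere.prod
          (.volumeIoiPow (Module.finrank ℝ (EuclideanSpace ℂ ι) - 1)) := by
        rw [← (Measure.measurePreserving_homeomorphUnitSphereProd
          (volume : Measure (EuclideanSpace ℂ ι))).integral_comp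
          (Homeomorph.measurableEmbedding _)]
        congr 1
        ext x
        have hx : ‖x.1‖ ≠ 0 := norm_ne_zero_iff.2 x.2
        have h1 : x.1 = ‖x.1‖ • (‖x.1‖⁻¹ • x.1) := by rw [smul_inv_smul₀ hx]
        simp only [hG, gaussWeight, homeomorphUnitSphereProd_apply_fst_coe,
          homeomorphUnitSphereProd_apply_snd_coe]
        conv_lhs => rw [h1, hF]
        rw [← h1]
        ring
    _ = _ := by
        rw [integral_prod_mul (fun ψ : Metric.sphere (0 : EuclideanSpace ℂ ι) 1 => F ψ.1)
          (fun r : Set.Ioi (0 : ℝ) => r.1 ^ k * Real.exp (-r.1 ^ 2))]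
        congr 1
        simp only [Measure.volumeIoiPow, ENNReal.ofReal]
        rw [integral_withDensity_eq_integral_smul (by fun_prop),
          integral_subtype_comap measurableSet_Ioi fun a : ℝ =>
            Real.toNNReal (a ^ (Module.finrank ℝ (EuclideanSpace ℂ ι) - 1)) •
              (a ^ k * Real.exp (-a ^ 2))]
        -- With `d` the complex dimension, the radial integral is `∫ r^(2d - 1 + k) exp (-r²) = Γ(d
        -- + k/2) / 2`.
        have := integral_rpow_mul_exp_neg_rpow (p := 2)
          (q := ((Module.finrank ℝ (EuclideanSpace ℂ ι) - 1 + k : ℕ) : ℝ)) two_pos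
          (neg_one_lt_zero.trans_le (Nat.cast_nonneg _))
        rw [show ((Fintype.card ι : ℝ) + (k : ℝ) / 2) =
          (((Module.finrank ℝ (EuclideanSpace ℂ ι) - 1 + k : ℕ) : ℝ) + 1) / 2 by
            rw [hdim, Nat.cast_add, Nat.cast_sub (by omega)]; push_cast; ring,
          div_eq_inv_mul, ← one_div, ← this]
        refine setIntegral_congr_fun measurableSet_Ioi fun x hx => ?_
        have hx0 : (0 : ℝ) ≤ x := le_of_lt hx
        rw [NNReal.smul_def, Real.coe_toNNReal _ (by positivity), Real.rpow_natCast, smul_eq_mul,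
          pow_add, mul_assoc]
        norm_cast

/-- Both integrands are homogeneous, of degrees `2 s.card` and `2 (s.card + 1)`. Their radial
factors have ratio `Γ(d + s.card + 1) / Γ(d + s.card) = d + s.card`, which becomes the denominator
when the Gaussian inequality is restricted to the sphere. -/
lemma integral_sphere_prod_insert_ge [Nonempty ι] {κ : Type*} (s : Finset κ)
    (b : κ → EuclideanSpace ℂ ι) (a : EuclideanSpace ℂ ι) :
    ‖a‖ ^ 2 / (Fintype.card ι + s.card) *
        ∫ ψ : Metric.sphere (0 : EuclideanSpace ℂ ι) 1, ∏ i ∈ s, ‖(inner ℂ (b i) ψ.1 : ℂ)‖ ^ 2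
          ∂(volume : Measure (EuclideanSpace ℂ ι)).toSphere ≤
      ∫ ψ : Metric.sphere (0 : EuclideanSpace ℂ ι) 1,
        ‖(inner ℂ a ψ.1 : ℂ)‖ ^ 2 * ∏ i ∈ s, ‖(inner ℂ (b i) ψ.1 : ℂ)‖ ^ 2
          ∂(volume : Measure (EuclideanSpace ℂ ι)).toSphere := by
  have hsm (r : ℝ) (c z : EuclideanSpace ℂ ι) :
      ‖(inner ℂ c (r • z) : ℂ)‖ ^ 2 = r ^ 2 * ‖(inner ℂ c z : ℂ)‖ ^ 2 := by
    rw [show r • z = (r : ℂ) • z by ext; simp, inner_smul_right, norm_mul, mul_pow,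
      Complex.norm_real, Real.norm_eq_abs, sq_abs]
  have h1 (r : ℝ) (z : EuclideanSpace ℂ ι) : ∏ i ∈ s, ‖(inner ℂ (b i) (r • z) : ℂ)‖ ^ 2 =
      r ^ (2 * s.card) * ∏ i ∈ s, ‖(inner ℂ (b i) z : ℂ)‖ ^ 2 := by
    simp_rw [hsm, Finset.prod_mul_distrib, Finset.prod_const, pow_mul]
  have h2 (r : ℝ) (z : EuclideanSpace ℂ ι) :
      ‖(inner ℂ a (r • z) : ℂ)‖ ^ 2 * ∏ i ∈ s, ‖(inner ℂ (b i) (r • z) : ℂ)‖ ^ 2 =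
      r ^ (2 * (s.card + 1)) *
        (‖(inner ℂ a z : ℂ)‖ ^ 2 * ∏ i ∈ s, ‖(inner ℂ (b i) z : ℂ)‖ ^ 2) := by
    rw [hsm, h1]
    ring
  have key := integral_normSq_inner_mul_ge a (PolyFun.prod s b)
  simp only [norm_prod, ← Finset.prod_pow] at key
  rw [integral_homogeneous_mul_gaussWeight _ h1, integral_homogeneous_mul_gaussWeight _ h2] at key
  have hd : (0 : ℝ) < Fintype.card ι := Nat.cast_pos.2 Fintype.card_pos
  have hG : Real.Gamma (Fintype.card ι + ((2 * (s.card + 1) : ℕ) : ℝ) / 2) =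
      (Fintype.card ι + s.card) * Real.Gamma (Fintype.card ι + ((2 * s.card : ℕ) : ℝ) / 2) := by
    have e1 : (Fintype.card ι + ((2 * (s.card + 1) : ℕ) : ℝ) / 2 : ℝ) =
      (Fintype.card ι + s.card) + 1 := by push_cast; ring
    have e2 : (Fintype.card ι + ((2 * s.card : ℕ) : ℝ) / 2 : ℝ) =
      (Fintype.card ι + s.card) := by push_cast; ring
    rw [e1, e2, Real.Gamma_add_one (by positivity)]
  have hGpos : 0 < Real.Gamma (Fintype.card ι + ((2 * s.card : ℕ) : ℝ) / 2) :=
    Real.Gamma_pos_of_pos (by positivity)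
  rw [hG] at key
  rw [div_mul_eq_mul_div, div_le_iff₀ (by positivity)]
  refine le_of_mul_le_mul_right ?_ (half_pos hGpos)
  linarith

instance instIsProbabilityMeasureHaarState (n : ℕ) : IsProbabilityMeasure (haarState n) := by
  have : Nonempty (Bits n) := inferInstance
  unfold haarState
  refine ⟨?_⟩
  rw [Measure.smul_apply, smul_eq_mul]
  refine ENNReal.inv_mul_cancel ?_ (measure_ne_top _ _)
  rw [Measure.measure_univ_ne_zero]
  exact Measure.toSphere_ne_zero _

lemma integrable_haarState {n : ℕ} {F : EuclideanSpace ℂ (Bits n) → ℝ} (hF : Continuous F) :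
    Integrable (fun ψ : PureState n => F ψ.1) (haarState n) :=
  (hF.comp continuous_subtype_val).integrable_of_hasCompactSupport
    (HasCompactSupport.of_compactSpace _)

/-- Factors are inserted one at a time. The denominators `2 ^ n + s.card` are weakened to the common
value `2 ^ n + T`, so that the bounds for all subsets of `T` factors can be resummed into one
product. -/
lemma integral_haarState_prod_ge {n : ℕ} {κ : Type*} (s : Finset κ)
    (b : κ → EuclideanSpace ℂ (Bits n)) (T : ℕ) (hT : s.card ≤ T) :
    ∏ i ∈ s, ‖b i‖ ^ 2 / (2 ^ n + T) ≤
      ∫ ψ : PureState n, ∏ i ∈ s, ‖(inner ℂ (b i) ψ.1 : ℂ)‖ ^ 2 ∂haarState n := by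
  classical
  induction s using Finset.induction_on with
  | empty => simp
  | insert i s hi ih =>
    rw [Finset.card_insert_of_notMem hi] at hT
    have h1 := integral_sphere_prod_insert_ge s b (b i)
    have h2 := ih (by omega)
    simp only [Finset.prod_insert hi]
    unfold haarState at h2 ⊢
    rw [integral_smul_measure] at h2 ⊢
    set c := (((volume : Measure (EuclideanSpace ℂ (Bits n))).toSphere Set.univ)⁻¹).toReal
    have hc : 0 ≤ c := ENNReal.toReal_nonneg
    have hcard : (Fintype.card (Bits n) : ℝ) = 2 ^ n := by simp
    rw [hcard] at h1
    simp only [smul_eq_mul] at h2 ⊢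
    have hsT : (s.card : ℝ) ≤ T := by exact_mod_cast (by omega)
    have hI : 0 ≤ ∫ ψ : PureState n, ∏ i ∈ s, ‖(inner ℂ (b i) ψ.1 : ℂ)‖ ^ 2
        ∂(volume : Measure (EuclideanSpace ℂ (Bits n))).toSphere :=
      integral_nonneg fun ψ => by positivity
    calc ‖b i‖ ^ 2 / (2 ^ n + T) * ∏ i ∈ s, ‖b i‖ ^ 2 / (2 ^ n + T)
        ≤ ‖b i‖ ^ 2 / (2 ^ n + s.card) * (c * ∫ ψ : PureState n,
            ∏ i ∈ s, ‖(inner ℂ (b i) ψ.1 : ℂ)‖ ^ 2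
            ∂(volume : Measure (EuclideanSpace ℂ (Bits n))).toSphere) := by
          gcongr
      _ ≤ _ := by
          rw [mul_left_comm]
          gcongr

/-- Averages of products of the form `‖⟨b i, ψ⟩‖² + β i`. -/
lemma integral_haarState_prod_add_ge {n T : ℕ} (b : Fin T → EuclideanSpace ℂ (Bits n))
    (β : Fin T → ℝ) (hβ : ∀ i, 0 ≤ β i) :
    ∏ i, (‖b i‖ ^ 2 / (2 ^ n + T) + β i) ≤
      ∫ ψ : PureState n, ∏ i, (‖(inner ℂ (b i) ψ.1 : ℂ)‖ ^ 2 + β i) ∂haarState n := by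
  -- Both products are expanded over the subsets of indices that contribute the non-constant term,
  -- and compared subset by subset.
  simp_rw [Finset.prod_add]
  rw [integral_finsetSum _ fun s _ => integrable_haarState
    (F := fun z => (∏ i ∈ s, ‖(inner ℂ (b i) z : ℂ)‖ ^ 2) * ∏ i ∈ Finset.univ \ s, β i)
    (by fun_prop)]
  refine Finset.sum_le_sum fun s _ => ?_
  rw [integral_mul_const]
  refine mul_le_mul_of_nonneg_right (integral_haarState_prod_ge s b T ?_)
    (Finset.prod_nonneg fun i _ => hβ i)
  simpa using s.card_le_univ

end Sphere

/-! ### Learning trees on flagged Haar random states -/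

section Trees

open MeasureTheory

/-- `½ |b⟩⟨b| ⊗ |ψ⟩⟨ψ| + ½ |!b⟩⟨!b| ⊗ I / 2^m`: this is `rhoA` for `b = 0` and `rhoB` for `b = 1`. -/
noncomputable def flagState {m : ℕ} (b : Bool) (ψ : PureState m) :
    Matrix (Bits (m + 1)) (Bits (m + 1)) ℂ :=
  (1 / 2 : ℂ) • flagged b (ketbra ψ) + (1 / 2 : ℂ) • flagged (!b) (maxMixed m)

lemma rhoA_eq_flagState {m : ℕ} (ψ : PureState m) : rhoA ψ = flagState false ψ := rfl

lemma rhoB_eq_flagState {m : ℕ} (ψ : PureState m) : rhoB ψ = flagState true ψ := rfl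

/-- Append `b` as the first tensor factor. -/
def snocBit {m : ℕ} (c : Bits m) (b : Bool) : Bits (m + 1) := Fin.snoc (α := fun _ => Bool) c b

@[simp] lemma snocBit_last {m : ℕ} (c : Bits m) (b : Bool) : snocBit c b (Fin.last m) = b := by
  simp [snocBit]

@[simp] lemma snocBit_castSucc {m : ℕ} (c : Bits m) (b : Bool) (i : Fin m) :
    snocBit c b i.castSucc = c i := by
  simp [snocBit]

lemma sum_snocBit {m : ℕ} {M : Type*} [AddCommMonoid M] (F : Bits (m + 1) → M) (b : Bool) :
    ∑ x, F x = ∑ c, F (snocBit c b) + ∑ c, F (snocBit c !b) := by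
  rw [← (Fin.snocEquiv fun _ : Fin (m + 1) => Bool).sum_comp, Fintype.sum_prod_type,
    Fintype.sum_bool]
  cases b
  · exact add_comm _ _
  · rfl

/-- The component of `v` in which the first tensor factor is `|b⟩`. -/
noncomputable def bitSlice {m : ℕ} (b : Bool) (v : EuclideanSpace ℂ (Bits (m + 1))) :
    EuclideanSpace ℂ (Bits m) :=
  WithLp.toLp 2 fun c => v (snocBit c b)

lemma norm_sq_bitSlice_add {m : ℕ} (b : Bool) (v : PureState (m + 1)) :
    ‖bitSlice b v.1‖ ^ 2 + ‖bitSlice (!b) v.1‖ ^ 2 = 1 := by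
  have h : ‖v.1‖ ^ 2 = 1 := by simp
  rw [EuclideanSpace.norm_sq_eq, sum_snocBit _ b] at h
  rw [EuclideanSpace.norm_sq_eq, EuclideanSpace.norm_sq_eq]
  exact h

lemma quadForm_flagged {m : ℕ} (b : Bool) (σ : Matrix (Bits m) (Bits m) ℂ)
    (v : EuclideanSpace ℂ (Bits (m + 1))) :
    ∑ x, ∑ y, conj (v x) * flagged b σ x y * v y =
      ∑ x, ∑ y, conj (bitSlice b v x) * σ x y * bitSlice b v y := by
  simp_rw [sum_snocBit _ b]
  simp [flagged, bitSlice]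

lemma quadForm_ketbra {m : ℕ} (ψ : PureState m) (v : EuclideanSpace ℂ (Bits m)) :
    ∑ x, ∑ y, conj (v x) * ketbra ψ x y * v y = ((‖(inner ℂ v ψ.1 : ℂ)‖ ^ 2 : ℝ) : ℂ) := by
  rw [← Complex.normSq_eq_norm_sq, ← Complex.mul_conj, PiLp.inner_apply, map_sum, Finset.sum_mul_sum]
  refine Finset.sum_congr rfl fun x _ => Finset.sum_congr rfl fun y _ => ?_
  simp [ketbra]
  ring

lemma quadForm_maxMixed {m : ℕ} (v : EuclideanSpace ℂ (Bits m)) :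
    ∑ x, ∑ y, conj (v x) * maxMixed m x y * v y = ((‖v‖ ^ 2 / 2 ^ m : ℝ) : ℂ) := by
  have (x : Bits m) : ∑ y, conj (v x) * maxMixed m x y * v y = ((‖v x‖ ^ 2 / 2 ^ m : ℝ) : ℂ) := by
    rw [Finset.sum_eq_single x]
    · simp only [maxMixed, Matrix.smul_apply, Matrix.one_apply_eq, smul_eq_mul, mul_one]
      push_cast
      rw [← Complex.conj_mul']
      ring
    · intro y _ hy
      simp [maxMixed, Matrix.one_apply_ne hy.symm]
    · simp
  simp_rw [this]
  rw [EuclideanSpace.norm_sq_eq, Finset.sum_div]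
  push_cast
  rfl

lemma RankOnePOVM.prob_flagState {m r : ℕ} (M : RankOnePOVM (m + 1) r) (b : Bool)
    (ψ : PureState m) (s : Fin r) :
    M.prob (flagState b ψ) s = M.weight s / 2 *
      (‖(inner ℂ (bitSlice b (M.vec s).1) ψ.1 : ℂ)‖ ^ 2 +
        ‖bitSlice (!b) (M.vec s).1‖ ^ 2 / 2 ^ m) := by
  have : ∑ x, ∑ y, conj ((M.vec s).1 x) * flagState b ψ x y * (M.vec s).1 y =
      (((‖(inner ℂ (bitSlice b (M.vec s).1) ψ.1 : ℂ)‖ ^ 2 +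
        ‖bitSlice (!b) (M.vec s).1‖ ^ 2 / 2 ^ m) / 2 : ℝ) : ℂ) := by
    have (x y : Bits (m + 1)) : conj ((M.vec s).1 x) * flagState b ψ x y * (M.vec s).1 y =
        (1 / 2) * (conj ((M.vec s).1 x) * flagged b (ketbra ψ) x y * (M.vec s).1 y) +
        (1 / 2) * (conj ((M.vec s).1 x) * flagged (!b) (maxMixed m) x y * (M.vec s).1 y) := by
      simp only [flagState, Matrix.add_apply, Matrix.smul_apply, smul_eq_mul]
      ring
    simp_rw [this, Finset.sum_add_distrib, ← Finset.mul_sum]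
    rw [quadForm_flagged, quadForm_flagged, quadForm_ketbra, quadForm_maxMixed]
    push_cast
    ring
  rw [RankOnePOVM.prob, this, Complex.ofReal_re]
  ring

lemma RankOnePOVM.prob_maxMixed {n r : ℕ} (M : RankOnePOVM n r) (s : Fin r) :
    M.prob (maxMixed n) s = M.weight s / 2 ^ n := by
  rw [RankOnePOVM.prob, quadForm_maxMixed, Complex.ofReal_re]
  simp
  ring

/-- Completeness of the POVM, read entrywise: summing over `s` leaves only the diagonal of `ρ`. -/
lemma RankOnePOVM.sum_prob {n r : ℕ} (M : RankOnePOVM n r) (ρ : Matrix (Bits n) (Bits n) ℂ) :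
    ∑ s, M.prob ρ s = ρ.trace.re := by
  have h (x y : Bits n) : ∑ s, (M.weight s : ℂ) * (conj ((M.vec s).1 x) * ρ x y * (M.vec s).1 y) =
      if y = x then ρ x y else 0 := by
    have := congr_fun (congr_fun M.sum_eq_one y) x
    simp only [Matrix.sum_apply, Matrix.smul_apply, ketbra, Matrix.of_apply, smul_eq_mul,
      Matrix.one_apply] at this
    rw [← mul_boole, ← this, Finset.mul_sum]
    exact Finset.sum_congr rfl fun s _ => by ring
  have h2 (s : Fin r) : M.prob ρ s = (∑ x, ∑ y,
      (M.weight s : ℂ) * (conj ((M.vec s).1 x) * ρ x y * (M.vec s).1 y)).re := by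
    simp_rw [← Finset.mul_sum]
    rw [Complex.re_ofReal_mul, RankOnePOVM.prob]
  simp_rw [h2]
  rw [← Complex.re_sum, Finset.sum_comm]
  congr 1
  refine Finset.sum_congr rfl fun x _ => ?_
  rw [Finset.sum_comm]
  simp [h]

lemma trace_maxMixed (n : ℕ) : (maxMixed n).trace = 1 := by
  simp [maxMixed, Matrix.trace_smul]

lemma trace_flagged {m : ℕ} (b : Bool) (σ : Matrix (Bits m) (Bits m) ℂ) :
    (flagged b σ).trace = σ.trace := by
  rw [Matrix.trace, sum_snocBit _ b]
  simp [flagged, Matrix.trace]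

lemma trace_ketbra {m : ℕ} (ψ : PureState m) : (ketbra ψ).trace = 1 := by
  have h : ‖ψ.1‖ ^ 2 = 1 := by simp
  rw [EuclideanSpace.norm_sq_eq] at h
  simp only [Matrix.trace, Matrix.diag_apply, ketbra, Matrix.of_apply, Complex.mul_conj']
  exact_mod_cast h

lemma trace_flagState {m : ℕ} (b : Bool) (ψ : PureState m) : (flagState b ψ).trace = 1 := by
  rw [flagState, Matrix.trace_add, Matrix.trace_smul, Matrix.trace_smul, trace_flagged,
    trace_flagged, trace_ketbra, trace_maxMixed]
  norm_num

lemma posSemidef_ketbra {m : ℕ} (ψ : PureState m) : (ketbra ψ).PosSemidef :=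
  Matrix.posSemidef_vecMulVec_self_star _

lemma posSemidef_maxMixed (m : ℕ) : (maxMixed m).PosSemidef := by
  have : (0 : ℂ) ≤ ((2 : ℂ) ^ m)⁻¹ := by positivity
  exact Matrix.PosSemidef.one.smul this

lemma posSemidef_flagged {m : ℕ} (b : Bool) {σ : Matrix (Bits m) (Bits m) ℂ} (hσ : σ.PosSemidef) :
    (flagged b σ).PosSemidef := by
  rw [Matrix.posSemidef_iff_dotProduct_mulVec] at hσ ⊢
  refine ⟨?_, fun v => ?_⟩
  · ext x y
    have := hσ.1.apply (fun c => x c.castSucc) (fun c => y c.castSucc)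
    simp only [flagged, Matrix.conjTranspose_apply, Matrix.of_apply]
    by_cases hx : x (Fin.last m) = b <;> by_cases hy : y (Fin.last m) = b <;> simp [hx, hy]
    exact this
  · have h1 := hσ.2 (bitSlice b (WithLp.toLp 2 v)).ofLp
    have h2 := quadForm_flagged b σ (WithLp.toLp 2 v)
    simp only [dotProduct, Matrix.mulVec, Finset.mul_sum, ← mul_assoc] at h1 ⊢
    exact h1.trans_eq h2.symm

lemma posSemidef_flagState {m : ℕ} (b : Bool) (ψ : PureState m) : (flagState b ψ).PosSemidef := by
  have : (0 : ℂ) ≤ 1 / 2 := by positivity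
  exact ((posSemidef_flagged b (posSemidef_ketbra ψ)).smul this).add
    ((posSemidef_flagged _ (posSemidef_maxMixed m)).smul this)

/-- Condition on the first outcome `s`: the rest of the transcript runs through the subtree with
nodes `s :: u`, to which the induction hypothesis applies since `g` is general. -/
lemma sum_prod_take_ofFn {r : ℕ} {M : Type*} [CommSemiring M] (g : List (Fin r) → Fin r → M)
    (hg : ∀ u, ∑ s, g u s = 1) (T : ℕ) :
    ∑ ℓ : Fin T → Fin r, ∏ i : Fin T, g ((List.ofFn ℓ).take i) (ℓ i) = 1 := by
  induction T generalizing g with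
  | zero => simp
  | succ T ih =>
    rw [← (Fin.consEquiv fun _ : Fin (T + 1) => Fin r).sum_comp, Fintype.sum_prod_type]
    have h (s : Fin r) (ℓ : Fin T → Fin r) :
        ∏ i : Fin (T + 1), g ((List.ofFn (Fin.consEquiv (fun _ : Fin (T + 1) => Fin r) (s, ℓ))).take i)
          (Fin.consEquiv (fun _ : Fin (T + 1) => Fin r) (s, ℓ) i) =
        g [] s * ∏ i : Fin T, g (s :: (List.ofFn ℓ).take i) (ℓ i) := by
      rw [Fin.prod_univ_succ]
      simp [Fin.consEquiv, List.ofFn_succ]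
    simp_rw [h, ← Finset.mul_sum]
    have h' (s : Fin r) : ∑ ℓ : Fin T → Fin r,
        ∏ i : Fin T, g (s :: (List.ofFn ℓ).take i) (ℓ i) = 1 :=
      ih (fun u => g (s :: u)) fun u => hg _
    simp_rw [h', mul_one]
    exact hg []

lemma LearningTree.sum_leafProb {n : ℕ} (𝒯 : LearningTree n) {ρ : Matrix (Bits n) (Bits n) ℂ}
    (hρ : ρ.trace = 1) : ∑ ℓ, 𝒯.leafProb ρ ℓ = 1 :=
  sum_prod_take_ofFn (fun u s => (𝒯.povm u).prob ρ s)
    (fun u => by rw [RankOnePOVM.sum_prob, hρ, Complex.one_re]) 𝒯.depth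

lemma one_sub_le_div_pow {d : ℝ} (hd : 0 < d) (T : ℕ) :
    1 - (T : ℝ) ^ 2 / d ≤ (d / (d + T)) ^ T := by
  have hT : (0 : ℝ) ≤ T := T.cast_nonneg
  have h1 : d / (d + T) = 1 + -(T / (d + T)) := by field_simp; ring
  have h2 : T / (d + T) ≤ 1 := (div_le_one (by positivity)).2 (by linarith)
  -- Bernoulli's inequality for `(1 - T / (d + T)) ^ T`.
  rw [h1]
  refine le_trans ?_ (one_add_mul_le_pow (by linarith) T)
  have h3 : T / (d + T) ≤ T / d := by gcongr; linarith
  have h4 := mul_le_mul_of_nonneg_left h3 hT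
  have h5 : (T : ℝ) ^ 2 / d = T * (T / d) := by ring
  rw [h5]
  linarith

/-- The weights `∏ w/2` are common to both sides. Each remaining factor of the Haar bound is at
least `1 / (2^m + T)`, because the squared norms of the two slices of a unit vector add up to `1`,
whichever slice is paired with `ψ`; the mixed state has `1 / 2^m` in its place. -/
lemma LearningTree.leafProb_maxMixed_le {m : ℕ} (𝒯 : LearningTree (m + 1)) (b : Bool)
    (ℓ : 𝒯.Leaf) :
    (1 - (𝒯.depth : ℝ) ^ 2 / 2 ^ m) * 𝒯.leafProb (maxMixed (m + 1)) ℓ ≤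
      ∫ ψ : PureState m, 𝒯.leafProb (flagState b ψ) ℓ ∂haarState m := by
  set T := 𝒯.depth
  set M : Fin T → RankOnePOVM (m + 1) 𝒯.r := fun i => 𝒯.povm ((List.ofFn ℓ).take i) with hM
  set d : ℝ := 2 ^ m with hd
  have hd0 : 0 < d := by positivity
  have hw : 0 ≤ ∏ i, (M i).weight (ℓ i) / 2 :=
    Finset.prod_nonneg fun i _ => div_nonneg ((M i).weight_nonneg _) two_pos.le
  have key := integral_haarState_prod_add_ge (fun i => bitSlice b ((M i).vec (ℓ i)).1)
    (fun i => ‖bitSlice (!b) ((M i).vec (ℓ i)).1‖ ^ 2 / d) (fun i => by positivity)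
  have hR : ∫ ψ : PureState m, 𝒯.leafProb (flagState b ψ) ℓ ∂haarState m =
      (∏ i, (M i).weight (ℓ i) / 2) * ∫ ψ : PureState m,
        ∏ i, (‖(inner ℂ (bitSlice b ((M i).vec (ℓ i)).1) ψ.1 : ℂ)‖ ^ 2 +
          ‖bitSlice (!b) ((M i).vec (ℓ i)).1‖ ^ 2 / d) ∂haarState m := by
    rw [← integral_const_mul]
    congr 1
    ext ψ
    rw [← Finset.prod_mul_distrib]
    exact Finset.prod_congr rfl fun i _ => (M i).prob_flagState b ψ (ℓ i)
  have hL : 𝒯.leafProb (maxMixed (m + 1)) ℓ = (∏ i, (M i).weight (ℓ i) / 2) * (1 / d) ^ T := by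
    rw [← Fin.prod_const, ← Finset.prod_mul_distrib]
    refine Finset.prod_congr rfl fun i _ => ((M i).prob_maxMixed (ℓ i)).trans ?_
    rw [hd, pow_succ]
    ring
  rw [hR, hL, mul_left_comm]
  refine mul_le_mul_of_nonneg_left (le_trans ?_ key) hw
  calc (1 - (T : ℝ) ^ 2 / d) * (1 / d) ^ T ≤ (d / (d + T)) ^ T * (1 / d) ^ T := by
        gcongr
        exact one_sub_le_div_pow hd0 T
    _ = ∏ _i : Fin T, 1 / (d + T) := by
        rw [Fin.prod_const, ← mul_pow]
        congr 1
        field_simp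
    _ ≤ _ := by
        refine Finset.prod_le_prod (fun i _ => by positivity) fun i _ => ?_
        have h1 := norm_sq_bitSlice_add b ((M i).vec (ℓ i))
        have hT : (0 : ℝ) ≤ T := T.cast_nonneg
        calc 1 / (d + T) = ‖bitSlice b ((M i).vec (ℓ i)).1‖ ^ 2 / (d + T) +
              ‖bitSlice (!b) ((M i).vec (ℓ i)).1‖ ^ 2 / (d + T) := by rw [← add_div, h1]
          _ ≤ _ := by
            gcongr
            linarith

/-- The probability that running the tree on `ρ` and applying the decision gives `1`. -/
noncomputable def LearningTree.decisionProb {n : ℕ} (𝒯 : LearningTree n) (dec : 𝒯.Leaf → Bool)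
    (ρ : Matrix (Bits n) (Bits n) ℂ) : ℝ :=
  ∑ ℓ : 𝒯.Leaf, if dec ℓ = true then 𝒯.leafProb ρ ℓ else 0

lemma LearningTree.leafProb_maxMixed_nonneg {n : ℕ} (𝒯 : LearningTree n) (ℓ : 𝒯.Leaf) :
    0 ≤ 𝒯.leafProb (maxMixed n) ℓ :=
  Finset.prod_nonneg fun i _ => by
    rw [RankOnePOVM.prob_maxMixed]
    exact div_nonneg (RankOnePOVM.weight_nonneg _ _) (by positivity)

lemma LearningTree.integrable_leafProb {m : ℕ} (𝒯 : LearningTree (m + 1)) (b : Bool)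
    (ℓ : 𝒯.Leaf) : Integrable (fun ψ => 𝒯.leafProb (flagState b ψ) ℓ) (haarState m) := by
  simp only [LearningTree.leafProb, RankOnePOVM.prob_flagState]
  exact integrable_haarState (F := fun z => ∏ i : Fin 𝒯.depth, ((𝒯.povm ((List.ofFn ℓ).take i)).weight (ℓ i) / 2 *
      (‖(inner ℂ (bitSlice b ((𝒯.povm ((List.ofFn ℓ).take i)).vec (ℓ i)).1) z : ℂ)‖ ^ 2 +
        ‖bitSlice (!b) ((𝒯.povm ((List.ofFn ℓ).take i)).vec (ℓ i)).1‖ ^ 2 / 2 ^ m))) (by fun_prop)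

lemma LearningTree.decisionProb_maxMixed_le {m : ℕ} (𝒯 : LearningTree (m + 1)) (b : Bool)
    (dec : 𝒯.Leaf → Bool) :
    𝒯.decisionProb dec (maxMixed (m + 1)) - (𝒯.depth : ℝ) ^ 2 / 2 ^ m ≤
      ∫ ψ : PureState m, 𝒯.decisionProb dec (flagState b ψ) ∂haarState m := by
  have h1 : 𝒯.decisionProb dec (maxMixed (m + 1)) ≤ 1 := by
    rw [← 𝒯.sum_leafProb (trace_maxMixed _)]
    refine Finset.sum_le_sum fun ℓ _ => ?_
    split_ifs
    exacts [le_rfl, 𝒯.leafProb_maxMixed_nonneg ℓ]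
  have h2 : (1 - (𝒯.depth : ℝ) ^ 2 / 2 ^ m) * 𝒯.decisionProb dec (maxMixed (m + 1)) ≤
      ∫ ψ : PureState m, 𝒯.decisionProb dec (flagState b ψ) ∂haarState m := by
    simp only [LearningTree.decisionProb, ← Finset.sum_filter]
    rw [integral_finsetSum _ fun ℓ _ => 𝒯.integrable_leafProb b ℓ, Finset.mul_sum]
    exact Finset.sum_le_sum fun ℓ _ => 𝒯.leafProb_maxMixed_le b ℓ
  have h3 : (0 : ℝ) ≤ (𝒯.depth : ℝ) ^ 2 / 2 ^ m := by positivity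
  -- `(1 - ε) p ≥ p - ε` for `p ≤ 1` and `ε ≥ 0`.
  nlinarith

/-- Applying a lower bound to the complementary decision yields the matching upper bound. -/
lemma LearningTree.decisionProb_not {n : ℕ} (𝒯 : LearningTree n) (dec : 𝒯.Leaf → Bool)
    {ρ : Matrix (Bits n) (Bits n) ℂ} (hρ : ρ.trace = 1) :
    𝒯.decisionProb (fun ℓ => !dec ℓ) ρ = 1 - 𝒯.decisionProb dec ρ := by
  rw [eq_sub_iff_add_eq, ← 𝒯.sum_leafProb hρ, LearningTree.decisionProb, LearningTree.decisionProb,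
    ← Finset.sum_add_distrib]
  refine Finset.sum_congr rfl fun ℓ _ => ?_
  cases dec ℓ <;> simp

/-- A tree of depth `T` distinguishes `flagState b ψ` with Haar random `ψ` from the maximally mixed
state with advantage at most `T² / 2^m`. -/
lemma LearningTree.abs_integral_decisionProb_sub_le {m : ℕ} (𝒯 : LearningTree (m + 1)) (b : Bool)
    (dec : 𝒯.Leaf → Bool) :
    |(∫ ψ : PureState m, 𝒯.decisionProb dec (flagState b ψ) ∂haarState m) -
      𝒯.decisionProb dec (maxMixed (m + 1))| ≤ (𝒯.depth : ℝ) ^ 2 / 2 ^ m := by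
  have h1 := 𝒯.decisionProb_maxMixed_le b dec
  have h2 := 𝒯.decisionProb_maxMixed_le b (fun ℓ => !dec ℓ)
  simp_rw [𝒯.decisionProb_not dec (trace_flagState b _)] at h2
  rw [𝒯.decisionProb_not dec (trace_maxMixed _), integral_sub (integrable_const _), integral_const]
    at h2
  · simp at h2
    rw [abs_le]
    constructor <;> linarith
  · unfold LearningTree.decisionProb
    refine integrable_finsetSum _ fun ℓ _ => ?_
    split_ifs
    exacts [𝒯.integrable_leafProb b ℓ, integrable_zero _ _ _]

end Trees

/-! ### Calculus of negligible functions -/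

section NegligibleFunctions

lemma Negligible.mono {f g : ℕ → ℝ} (hg : Negligible g) (h : ∀ n, f n ≤ g n) : Negligible f :=
  fun c hc => (hg c hc).mono fun n hn => (h n).trans_lt hn

lemma Negligible.add {f g : ℕ → ℝ} (hf : Negligible f) (hg : Negligible g) :
    Negligible fun n => f n + g n := by
  intro c hc
  -- The spare power of `n` absorbs the factor `2` once `n ≥ 2`.
  filter_upwards [hf (c + 1) (by linarith), hg (c + 1) (by linarith),
    Filter.eventually_ge_atTop 2] with n h1 h2 h3
  have hn : (2 : ℝ) ≤ n := by exact_mod_cast h3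
  have hn0 : (0 : ℝ) < n := by linarith
  have h4 : (n : ℝ) ^ (-c) = n * (n : ℝ) ^ (-(c + 1)) := by
    rw [neg_add, Real.rpow_add hn0, Real.rpow_neg_one]
    field_simp
  have h5 : 0 < (n : ℝ) ^ (-(c + 1)) := Real.rpow_pos_of_pos hn0 _
  rw [h4]
  nlinarith

lemma exists_eval_le_mul_pow (P : Polynomial ℕ) :
    ∀ n, 1 ≤ n → P.eval n ≤ P.eval 1 * n ^ P.natDegree := by
  intro n hn
  rw [Polynomial.eval_eq_sum_range, Polynomial.eval_eq_sum_range, Finset.sum_mul]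
  refine Finset.sum_le_sum fun i hi => ?_
  simp only [one_pow, mul_one]
  gcongr
  exact Nat.lt_succ_iff.1 (Finset.mem_range.1 hi)

lemma negligible_eval_div_two_pow (P : Polynomial ℕ) :
    Negligible fun n => ((P.eval n : ℕ) : ℝ) / 2 ^ n := by
  intro c hc
  obtain ⟨k, hk⟩ := exists_nat_ge c
  have h := (tendsto_pow_const_div_const_pow_of_one_lt (P.natDegree + k)
    (one_lt_two (α := ℝ))).const_mul ((P.eval 1 : ℕ) : ℝ)
  rw [mul_zero] at h
  filter_upwards [h.eventually_lt_const one_pos, Filter.eventually_ge_atTop 1] with n h1 h2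
  have hn1 : (1 : ℝ) ≤ n := by exact_mod_cast h2
  have hn : (0 : ℝ) < n := by linarith
  have h3 : ((P.eval n : ℕ) : ℝ) ≤ ((P.eval 1 : ℕ) : ℝ) * (n : ℝ) ^ P.natDegree := by
    exact_mod_cast exists_eval_le_mul_pow P n h2
  have h4 : (n : ℝ) ^ c ≤ (n : ℝ) ^ k := by
    rw [← Real.rpow_natCast]
    exact Real.rpow_le_rpow_of_exponent_le hn1 hk
  have h5 : (0 : ℝ) < (n : ℝ) ^ c := Real.rpow_pos_of_pos hn c
  rw [Real.rpow_neg hn.le, ← one_div, lt_div_iff₀ h5]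
  refine lt_of_le_of_lt ?_ h1
  calc ((P.eval n : ℕ) : ℝ) / 2 ^ n * (n : ℝ) ^ c
      ≤ (((P.eval 1 : ℕ) : ℝ) * (n : ℝ) ^ P.natDegree) / 2 ^ n * (n : ℝ) ^ k := by gcongr
    _ = _ := by rw [pow_add]; ring

end NegligibleFunctions

/-! ### From Haar random to pseudorandom states -/

section Conventional

open MeasureTheory

/-- The circuits `C m` simulate `A` on the states `flagState b ψ`, given copies of `ψ`. -/
def Simulates (A : ConventionalAlgorithm) (b : Bool) (C : ℕ → Circuit) : Prop :=
  IsPolyTime (fun m => (A.copies.comp (Polynomial.X + 1)).eval m) C ∧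
    ∀ m (ψ : PureState m),
      acceptProb (C m) (tensorPow ((A.copies.comp (Polynomial.X + 1)).eval m) (ketbra ψ)) =
        A.prob (flagState b ψ)

/-- The Haar average is the intermediate term: pseudorandomness against the simulating circuit
bounds one difference, the tree bound the other. The comparison state `maxMixed (m + 1)` does not
depend on `b`, so the two flags can be compared through it. -/
lemma Simulates.negligible {K : ℕ → Type*} {D : ∀ m, PMF (K m)} {φ : ∀ m, K m → PureState m}
    (hφ : IsPseudorandom D φ) {A : ConventionalAlgorithm} {b : Bool} {C : ℕ → Circuit}
    (hC : Simulates A b C) :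
    Negligible fun m => |(∑' k, (D m k).toReal * A.prob (flagState b (φ m k))) -
      A.prob (maxMixed (m + 1))| := by
  have h1 := hφ.indistinguishable _ C hC.1
  simp only [hC.2] at h1
  refine (h1.add (negligible_eval_div_two_pow ((A.copies.comp (Polynomial.X + 1)) ^ 2))).mono
    fun m => (abs_sub_le _ _ _).trans (add_le_add le_rfl
      (((A.tree (m + 1)).abs_integral_decisionProb_sub_le b (A.decision (m + 1))).trans ?_))
  have := A.depth_le (m + 1)
  simp only [Polynomial.eval_pow, Polynomial.eval_comp, Polynomial.eval_add, Polynomial.eval_X,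
    Polynomial.eval_one, Nat.cast_pow]
  gcongr

end Conventional

/-! ### Spectator qubits and decoherence -/

section Circuits

/-- All operands of the gate satisfy `P`. -/
def Gate.On {Q : Type} (P : Q → Prop) : Gate Q → Prop
  | H q => P q
  | T q => P q
  | X q => P q
  | CX a q => P a ∧ P q
  | CCX a b q => P a ∧ P b ∧ P q

lemma Gate.On.map {Q R : Type} {P : Q → Prop} {P' : R → Prop} {f : Q → R}
    (h : ∀ q, P q → P' (f q)) {g : Gate Q} (hg : g.On P) : (g.map f).On P' := by
  cases g <;> simp_all [Gate.On, Gate.map]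

lemma Gate.On.mono {Q : Type} {P P' : Q → Prop} (h : ∀ q, P q → P' q) {g : Gate Q} (hg : g.On P) :
    g.On P' := by
  cases g <;> simp_all [Gate.On]

lemma Gate.apply_single (g : Gate Qubit) (S : Finset Qubit) (a : ℂ) :
    g.apply (Finsupp.single S a) = a • g.onBasis S :=
  Finsupp.linearCombination_single ..

lemma Circuit.run_append (C₁ C₂ : Circuit) (v : Ket) :
    Circuit.run (C₁ ++ C₂) v = Circuit.run C₂ (Circuit.run C₁ v) := by
  induction C₁ generalizing v with
  | nil => rfl
  | cons g C ih => exact ih _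

/-- Adjoin the qubits in `G`, in the state `|1⟩`. -/
noncomputable def adjoinOnes (G : Finset Qubit) : Ket →ₗ[ℂ] Ket :=
  Finsupp.lmapDomain ℂ ℂ (· ∪ G)

@[simp] lemma adjoinOnes_single (G S : Finset Qubit) (a : ℂ) :
    adjoinOnes G (Finsupp.single S a) = Finsupp.single (S ∪ G) a := by
  simp [adjoinOnes]

lemma flipQubit_union {q : Qubit} {G : Finset Qubit} (hq : q ∉ G) (S : Finset Qubit) :
    flipQubit q (S ∪ G) = flipQubit q S ∪ G := by
  unfold flipQubit
  by_cases h : q ∈ S <;> simp [h, hq, Finset.erase_union_distrib, Finset.insert_union]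

lemma Gate.apply_adjoinOnes {G : Finset Qubit} {g : Gate Qubit} (hg : g.On (· ∉ G)) (v : Ket) :
    g.apply (adjoinOnes G v) = adjoinOnes G (g.apply v) := by
  induction v using Finsupp.induction_linear with
  | zero => simp
  | add u v hu hv => simp [hu, hv]
  | single S a =>
    rw [adjoinOnes_single, Gate.apply_single, Gate.apply_single, map_smul]
    congr 1
    cases g <;> simp only [Gate.On] at hg
    · simp [Gate.onBasis, hg, Finset.erase_union_distrib, Finset.insert_union]
    · simp [Gate.onBasis, hg]
    · simp [Gate.onBasis, flipQubit_union hg]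
    · simp only [Gate.onBasis, Finset.mem_union, hg, or_false, adjoinOnes_single,
        flipQubit_union hg.2]
      split_ifs <;> rfl
    · simp only [Gate.onBasis, Finset.mem_union, hg, or_false, adjoinOnes_single,
        flipQubit_union hg.2.2]
      split_ifs <;> rfl

/-- Qubits that no gate touches are spectators. This pulls the garbage of a preparation out of the
circuit that follows it. -/
lemma Circuit.run_adjoinOnes {G : Finset Qubit} {C : Circuit} (hC : ∀ g ∈ C, g.On (· ∉ G))
    (v : Ket) : C.run (adjoinOnes G v) = adjoinOnes G (C.run v) := by
  induction C generalizing v with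
  | nil => rfl
  | cons g C ih =>
    simp only [List.forall_mem_cons] at hC
    simp only [Circuit.run, LinearMap.comp_apply]
    rw [Gate.apply_adjoinOnes hC.1, ih hC.2]

/-- The vectors in which all qubits outside of `P` are in the state `|0⟩`. -/
noncomputable def supportedOn (P : Qubit → Prop) : Submodule ℂ Ket :=
  Finsupp.supported ℂ ℂ {S | ∀ q ∈ S, P q}

lemma single_mem_supportedOn {P : Qubit → Prop} {S : Finset Qubit} (hS : ∀ q ∈ S, P q) (a : ℂ) :
    (Finsupp.single S a : Ket) ∈ supportedOn P :=
  Finsupp.single_mem_supported ℂ a hS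

lemma Gate.apply_mem_supportedOn {P : Qubit → Prop} {g : Gate Qubit} (hg : g.On P) {v : Ket}
    (hv : v ∈ supportedOn P) : g.apply v ∈ supportedOn P := by
  have hflip {q : Qubit} (hq : P q) {S : Finset Qubit} (hS : ∀ q ∈ S, P q) :
      ∀ q' ∈ flipQubit q S, P q' := by
    intro q' hq'
    unfold flipQubit at hq'
    split_ifs at hq'
    · exact hS _ (Finset.mem_of_mem_erase hq')
    · rcases Finset.mem_insert.1 hq' with rfl | h
      exacts [hq, hS _ h]
  rw [Gate.apply, Finsupp.linearCombination_apply]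
  refine Submodule.sum_mem _ fun S hS => Submodule.smul_mem _ _ ?_
  replace hS : ∀ q ∈ S, P q := (Finsupp.mem_supported ℂ v).1 hv hS
  cases g <;> simp only [Gate.On] at hg <;> simp only [Gate.onBasis]
  · refine Submodule.add_mem _ (single_mem_supportedOn (fun q hq => ?_) _)
      (single_mem_supportedOn (fun q hq => ?_) _)
    · exact hS _ (Finset.mem_of_mem_erase hq)
    · rcases Finset.mem_insert.1 hq with rfl | h
      exacts [hg, hS _ h]
  · exact single_mem_supportedOn hS _
  · exact single_mem_supportedOn (hflip hg hS) _
  · refine single_mem_supportedOn ?_ _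
    split_ifs
    exacts [hflip hg.2 hS, hS]
  · refine single_mem_supportedOn ?_ _
    split_ifs
    exacts [hflip hg.2.2 hS, hS]

lemma Circuit.run_mem_supportedOn {P : Qubit → Prop} {C : Circuit} (hC : ∀ g ∈ C, g.On P) {v : Ket}
    (hv : v ∈ supportedOn P) : C.run v ∈ supportedOn P := by
  induction C generalizing v with
  | nil => exact hv
  | cons g C ih =>
    simp only [List.forall_mem_cons] at hC
    exact ih hC.2 (Gate.apply_mem_supportedOn hC.1 hv)

/-- The sesquilinear form `⟨v| Π |u⟩`, where `Π` projects on the basis states in which the output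
qubit is `1`. -/
noncomputable def outForm (u v : Ket) : ℂ :=
  u.sum fun S a => if outQubit ∈ S then a * conj (v S) else 0

lemma acceptProb_eq_outForm {t n : ℕ} (C : Circuit)
    (R : Matrix (Fin t → Bits n) (Fin t → Bits n) ℂ) :
    acceptProb C R = (∑ x, ∑ y, R x y *
      outForm (C.run (Finsupp.single (inputBasis x) 1))
        (C.run (Finsupp.single (inputBasis y) 1))).re := rfl

lemma outForm_add_left (u u' v : Ket) : outForm (u + u') v = outForm u v + outForm u' v := by
  refine Finsupp.sum_add_index' (fun S => by simp) fun S a b => ?_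
  split_ifs <;> ring

lemma outForm_smul_left (c : ℂ) (u v : Ket) : outForm (c • u) v = c * outForm u v := by
  unfold outForm
  rw [Finsupp.sum_smul_index fun S => by simp, Finsupp.mul_sum]
  congr! 2
  split_ifs <;> simp [mul_assoc]

lemma outForm_sum_left {κ : Type*} (s : Finset κ) (u : κ → Ket) (v : Ket) :
    outForm (∑ i ∈ s, u i) v = ∑ i ∈ s, outForm (u i) v := by
  classical
  induction s using Finset.induction_on with
  | empty => simp [outForm]
  | insert i s hi ih => rw [Finset.sum_insert hi, Finset.sum_insert hi, outForm_add_left, ih]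

lemma outForm_add_right (u v v' : Ket) : outForm u (v + v') = outForm u v + outForm u v' := by
  simp only [outForm, Finsupp.sum, ← Finset.sum_add_distrib]
  refine Finset.sum_congr rfl fun S _ => ?_
  split_ifs <;> simp [mul_add]

lemma outForm_smul_right (c : ℂ) (u v : Ket) : outForm u (c • v) = conj c * outForm u v := by
  simp only [outForm, Finsupp.sum, Finset.mul_sum]
  refine Finset.sum_congr rfl fun S _ => ?_
  split_ifs <;> simp [mul_left_comm]

lemma outForm_sum_right {κ : Type*} (s : Finset κ) (u : Ket) (v : κ → Ket) :
    outForm u (∑ i ∈ s, v i) = ∑ i ∈ s, outForm u (v i) := by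
  classical
  induction s using Finset.induction_on with
  | empty => simp [outForm]
  | insert i s hi ih => rw [Finset.sum_insert hi, Finset.sum_insert hi, outForm_add_right, ih]

lemma outForm_single_single (A B : Finset Qubit) (a b : ℂ) :
    outForm (Finsupp.single A a) (Finsupp.single B b) =
      if outQubit ∈ A ∧ A = B then a * conj b else 0 := by
  rw [outForm, Finsupp.sum_single_index (by simp), Finsupp.single_apply]
  by_cases h : outQubit ∈ A <;> by_cases h' : A = B <;> simp [h, h', eq_comm]

/-- Ancillary qubits in orthogonal basis states decohere. -/
lemma outForm_adjoinOnes {P : Qubit → Prop} (hP : P outQubit) {G G' : Finset Qubit}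
    (hG : ∀ q ∈ G, ¬ P q) (hG' : ∀ q ∈ G', ¬ P q) {u v : Ket} (hu : u ∈ supportedOn P)
    (hv : v ∈ supportedOn P) :
    outForm (adjoinOnes G u) (adjoinOnes G' v) = if G = G' then outForm u v else 0 := by
  -- `P` separates the working qubits from the garbage, so a union determines its two parts.
  have hinj {S S' H H' : Finset Qubit} (hS : ∀ q ∈ S, P q) (hS' : ∀ q ∈ S', P q)
      (hH : ∀ q ∈ H, ¬ P q) (hH' : ∀ q ∈ H', ¬ P q) (h : S ∪ H = S' ∪ H') : S = S' ∧ H = H' := by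
    constructor <;> ext q <;> have := Finset.ext_iff.1 h q <;>
      simp only [Finset.mem_union] at this <;> grind
  conv_lhs => rw [← Finsupp.sum_single u, ← Finsupp.sum_single v]
  conv_rhs => rw [← Finsupp.sum_single u, ← Finsupp.sum_single v]
  simp only [Finsupp.sum, map_sum, outForm_sum_left, outForm_sum_right, adjoinOnes_single,
    outForm_single_single]
  have hu' (S) (hS : S ∈ u.support) : ∀ q ∈ S, P q := (Finsupp.mem_supported ℂ u).1 hu hS
  have hv' (S) (hS : S ∈ v.support) : ∀ q ∈ S, P q := (Finsupp.mem_supported ℂ v).1 hv hS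
  rw [Finset.sum_comm, Finset.sum_comm (s := v.support)]
  split_ifs with h
  · subst h
    refine Finset.sum_congr rfl fun S hS => Finset.sum_congr rfl fun S' hS' => ?_
    have h1 : outQubit ∉ G := fun h => hG _ h hP
    have h2 : S ∪ G = S' ∪ G ↔ S = S' :=
      ⟨fun h => (hinj (hu' S hS) (hv' S' hS') hG hG h).1, fun h => by rw [h]⟩
    simp [h1, h2]
  · refine Finset.sum_eq_zero fun S hS => Finset.sum_eq_zero fun S' hS' => if_neg fun h' => h ?_
    exact (hinj (hu' S hS) (hv' S' hS') hG hG' h'.2).2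

lemma mem_inputBasis {t n : ℕ} (x : Fin t → Bits n) (q : Qubit) :
    q ∈ inputBasis x ↔ ∃ j c, x j c = true ∧ q = (0, (j : ℕ), (c : ℕ)) := by
  simp only [inputBasis, Finset.mem_image, Finset.mem_filter, Finset.mem_univ, true_and, Prod.exists]
  simp only [eq_comm (a := q)]

lemma mk_mem_inputBasis {t n : ℕ} (x : Fin t → Bits n) (r j c : ℕ) : (r, j, c) ∈ inputBasis x ↔
    r = 0 ∧ ∃ (hj : j < t) (hc : c < n), x ⟨j, hj⟩ ⟨c, hc⟩ = true := by
  rw [mem_inputBasis]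
  simp only [Prod.mk.injEq]
  constructor
  · rintro ⟨j, c, h, rfl, rfl, rfl⟩
    exact ⟨rfl, j.2, c.2, h⟩
  · rintro ⟨rfl, hj, hc, h⟩
    exact ⟨_, _, h, rfl, rfl, rfl⟩

lemma inputBasis_injective {t n : ℕ} : Function.Injective (inputBasis (t := t) (n := n)) := by
  intro x y h
  ext j c
  have := Finset.ext_iff.1 h (0, (j : ℕ), (c : ℕ))
  simp only [mem_inputBasis, Prod.mk.injEq, true_and, Fin.val_inj] at this
  rw [Bool.eq_iff_iff]
  grind

lemma sum_comm_four {α β γ δ ε M : Type*} [Fintype α] [Fintype β] [Fintype γ] [Fintype δ] [Fintype ε]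
    [AddCommMonoid M] (F : α → β → γ → δ → ε → M) :
    ∑ x, ∑ y, ∑ w, ∑ w', ∑ a, F x y w w' a = ∑ a, ∑ x, ∑ y, ∑ w, ∑ w', F x y w w' a := by
  calc _ = ∑ p : α × β × γ × δ, ∑ a, F p.1 p.2.1 p.2.2.1 p.2.2.2 a := by
        simp only [Fintype.sum_prod_type]
    _ = _ := by
        rw [Finset.sum_comm]
        simp only [Fintype.sum_prod_type]

/-- Prefixing a circuit by a preparation of a mixture of basis states with garbage. -/
lemma acceptProb_append {t t' n n' : ℕ} {W : Type*} [Fintype W] {P : Qubit → Prop}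
    (hout : P outQubit) (hP : ∀ j c, P (0, j, c)) {C₀ C : Circuit} (hC : ∀ g ∈ C, g.On P)
    (X : (Fin t → Bits n) → W → Fin t' → Bits n') (G : (Fin t → Bits n) → W → Finset Qubit)
    (hG : ∀ x w, ∀ q ∈ G x w, ¬ P q) (κ : ℝ)
    (hC₀ : ∀ x, C₀.run (Finsupp.single (inputBasis x) 1) =
      ∑ w, Finsupp.single (inputBasis (X x w) ∪ G x w) (κ : ℂ))
    (R : Matrix (Fin t → Bits n) (Fin t → Bits n) ℂ)
    (R' : Matrix (Fin t' → Bits n') (Fin t' → Bits n') ℂ)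
    (hR : ∀ a b, R' a b = ∑ x, ∑ y, ∑ w, ∑ w',
      if G x w = G y w' ∧ a = X x w ∧ b = X y w' then (κ : ℂ) ^ 2 * R x y else 0) :
    acceptProb (C₀ ++ C) R = acceptProb C R' := by
  have hPi {t n : ℕ} (x : Fin t → Bits n) : ∀ q ∈ inputBasis x, P q := by
    intro q hq
    obtain ⟨j, c, -, rfl⟩ := (mem_inputBasis x q).1 hq
    exact hP _ _
  have hform (x y w w') : outForm (C.run (Finsupp.single (inputBasis (X x w) ∪ G x w) (κ : ℂ)))
      (C.run (Finsupp.single (inputBasis (X y w') ∪ G y w') (κ : ℂ))) =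
      if G x w = G y w' then (κ : ℂ) ^ 2 * outForm (C.run (Finsupp.single (inputBasis (X x w)) 1))
        (C.run (Finsupp.single (inputBasis (X y w')) 1)) else 0 := by
    have e (x w) : C.run (Finsupp.single (inputBasis (X x w) ∪ G x w) (κ : ℂ)) =
        (κ : ℂ) • adjoinOnes (G x w) (C.run (Finsupp.single (inputBasis (X x w)) 1)) := by
      rw [← Circuit.run_adjoinOnes fun g hg => (hC g hg).mono fun q hq h => hG x w q h hq,
        adjoinOnes_single, ← map_smul, Finsupp.smul_single, smul_eq_mul, mul_one]
    rw [e, e, outForm_smul_left, outForm_smul_right, outForm_adjoinOnes hout (hG x w) (hG y w')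
      (Circuit.run_mem_supportedOn hC (single_mem_supportedOn (hPi _) _))
      (Circuit.run_mem_supportedOn hC (single_mem_supportedOn (hPi _) _))]
    split_ifs
    · rw [Complex.conj_ofReal]
      ring
    · simp
  rw [acceptProb_eq_outForm, acceptProb_eq_outForm]
  congr 1
  set K : (Fin t' → Bits n') → (Fin t' → Bits n') → ℂ := fun a b =>
    outForm (C.run (Finsupp.single (inputBasis a) 1)) (C.run (Finsupp.single (inputBasis b) 1))
    with hK
  calc _ = ∑ x, ∑ y, ∑ w, ∑ w', if G x w = G y w' then (κ : ℂ) ^ 2 * R x y *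
        K (X x w) (X y w') else 0 := by
        refine Finset.sum_congr rfl fun x _ => Finset.sum_congr rfl fun y _ => ?_
        rw [Circuit.run_append, Circuit.run_append, hC₀, hC₀, map_sum, map_sum, outForm_sum_left,
          Finset.mul_sum]
        refine Finset.sum_congr rfl fun w _ => ?_
        rw [outForm_sum_right, Finset.mul_sum]
        refine Finset.sum_congr rfl fun w' _ => ?_
        rw [hform]
        split_ifs
        · ring
        · simp
    -- The sums over `a` and `b` have one nonzero term each. They are inserted so that the
    -- coefficient of `K a b` becomes the entry `R' a b`.
    _ = ∑ x, ∑ y, ∑ w, ∑ w', ∑ a, ∑ b, (if G x w = G y w' ∧ a = X x w ∧ b = X y w' then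
          (κ : ℂ) ^ 2 * R x y else 0) * K a b := by
        refine Finset.sum_congr rfl fun x _ => Finset.sum_congr rfl fun y _ =>
          Finset.sum_congr rfl fun w _ => Finset.sum_congr rfl fun w' _ => ?_
        rw [Finset.sum_eq_single (X x w), Finset.sum_eq_single (X y w')]
        · by_cases h : G x w = G y w' <;> simp [h]
        · intro b _ hb
          simp [hb]
        · simp
        · intro a _ ha
          simp [ha]
        · simp
    _ = _ := by
        simp_rw [hR, Finset.sum_mul]
        rw [sum_comm_four]
        refine Finset.sum_congr rfl fun a _ => ?_
        rw [sum_comm_four]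

end Circuits

/-! ### Classical reversible circuits and Hadamard coins -/

section Classical

/-- The action of a gate other than `H` and `T` on basis states. -/
def Gate.toggle : Gate Qubit → Finset Qubit → Finset Qubit
  | H _, S => S
  | T _, S => S
  | X q, S => flipQubit q S
  | CX a q, S => if a ≠ q ∧ a ∈ S then flipQubit q S else S
  | CCX a b q, S => if a ≠ q ∧ b ≠ q ∧ a ∈ S ∧ b ∈ S then flipQubit q S else S

def Gate.IsClassical {Q : Type} : Gate Q → Prop
  | H _ => False
  | T _ => False
  | _ => True

def Circuit.toggle (C : Circuit) (S : Finset Qubit) : Finset Qubit :=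
  C.foldl (fun S g => g.toggle S) S

lemma Gate.apply_single_of_isClassical {g : Gate Qubit} (hg : g.IsClassical) (S : Finset Qubit)
    (a : ℂ) : g.apply (Finsupp.single S a) = Finsupp.single (g.toggle S) a := by
  rw [Gate.apply_single]
  cases g <;> simp_all [Gate.IsClassical, Gate.onBasis, Gate.toggle]

lemma Circuit.run_single_of_isClassical {C : Circuit} (hC : ∀ g ∈ C, g.IsClassical)
    (S : Finset Qubit) (a : ℂ) :
    C.run (Finsupp.single S a) = Finsupp.single (C.toggle S) a := by
  induction C generalizing S with
  | nil => rfl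
  | cons g C ih =>
    simp only [List.forall_mem_cons] at hC
    simp only [Circuit.run, LinearMap.comp_apply, Gate.apply_single_of_isClassical hC.1]
    exact ih hC.2 _

lemma mem_flipQubit (p q : Qubit) (S : Finset Qubit) :
    p ∈ flipQubit q S ↔ if p = q then q ∉ S else p ∈ S := by
  unfold flipQubit
  split_ifs with h1 h2 h2 <;> simp_all

lemma mem_toggle_X (q p : Qubit) (S : Finset Qubit) :
    p ∈ (Gate.X q).toggle S ↔ if p = q then q ∉ S else p ∈ S := mem_flipQubit p q S

lemma mem_toggle_CX {a q : Qubit} (h : a ≠ q) (p : Qubit) (S : Finset Qubit) :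
    p ∈ (Gate.CX a q).toggle S ↔ if p = q then ¬ (q ∈ S ↔ a ∈ S) else p ∈ S := by
  simp only [Gate.toggle]
  by_cases h1 : a ∈ S
  · by_cases hp : p = q <;> simp [h, h1, mem_flipQubit, hp]
  · by_cases hp : p = q <;> simp [h, h1, hp]

lemma mem_toggle_CCX {a b q : Qubit} (h : a ≠ q) (h' : b ≠ q) (p : Qubit) (S : Finset Qubit) :
    p ∈ (Gate.CCX a b q).toggle S ↔ if p = q then ¬ (q ∈ S ↔ a ∈ S ∧ b ∈ S) else p ∈ S := by
  simp only [Gate.toggle]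
  by_cases h1 : a ∈ S ∧ b ∈ S
  · by_cases hp : p = q <;> simp [h, h', h1, mem_flipQubit, hp]
  · by_cases hp : p = q <;> simp [h, h', h1, hp]

lemma Circuit.toggle_append (C₁ C₂ : Circuit) (S : Finset Qubit) :
    Circuit.toggle (C₁ ++ C₂) S = C₂.toggle (C₁.toggle S) :=
  List.foldl_append ..

/-- A sequence of blocks, each of which acts only on its own qubits and, apart from them, depends only
on qubits that no block acts on. -/
lemma Circuit.mem_toggle_flatMap {κ : Type*} [DecidableEq κ] (owner : Qubit → Option κ)
    (block : κ → Circuit) (F : κ → Finset Qubit → Qubit → Prop)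
    (hblock : ∀ k S p, p ∈ (block k).toggle S ↔ if owner p = some k then F k S p else p ∈ S)
    (hF : ∀ k S S', (∀ p, owner p = some k ∨ owner p = none → (p ∈ S ↔ p ∈ S')) →
      ∀ p, owner p = some k → (F k S p ↔ F k S' p))
    {l : List κ} (hl : l.Nodup) (S : Finset Qubit) (p : Qubit) :
    p ∈ Circuit.toggle (l.flatMap block) S ↔
      (∃ k ∈ l, owner p = some k ∧ F k S p) ∨ ((∀ k ∈ l, owner p ≠ some k) ∧ p ∈ S) := by
  induction l generalizing S with
  | nil => simp [Circuit.toggle]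
  | cons k l ih =>
    rw [List.nodup_cons] at hl
    rw [List.flatMap_cons, Circuit.toggle_append, ih hl.2]
    -- Block `k` has changed only its own qubits, and `F k'` reads none of them because `k' ≠ k`.
    have h1 : ∀ k' ∈ l, owner p = some k' → (F k' ((block k).toggle S) p ↔ F k' S p) := by
      intro k' hk' hpk
      refine hF k' _ _ (fun q hq => ?_) p hpk
      rw [hblock, if_neg]
      rintro h
      rcases hq with hq | hq
      · rw [h, Option.some.injEq] at hq
        exact hl.1 (hq ▸ hk')
      · rw [h] at hq
        cases hq
    have h2 := hblock k S p
    by_cases hp : owner p = some k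
    · have h3 : ∀ k' ∈ l, owner p ≠ some k' := by
        intro k' hk' h
        rw [hp, Option.some.injEq] at h
        exact hl.1 (h ▸ hk')
      rw [if_pos hp] at h2
      constructor
      · rintro (⟨k', hk', h, -⟩ | ⟨-, h⟩)
        · exact absurd h (h3 k' hk')
        · exact Or.inl ⟨k, List.mem_cons_self, hp, h2.1 h⟩
      · rintro (⟨k', hk', h, hf⟩ | ⟨h, -⟩)
        · rcases List.mem_cons.1 hk' with rfl | hk'
          · exact Or.inr ⟨h3, h2.2 hf⟩
          · exact absurd h (h3 k' hk')
        · exact absurd hp (h k List.mem_cons_self)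
    · rw [if_neg hp] at h2
      rw [h2]
      simp only [List.exists_mem_cons_iff, List.forall_mem_cons, hp, false_and, false_or, ne_eq,
        not_false_eq_true, true_and]
      refine or_congr_left ⟨?_, ?_⟩
      · rintro ⟨k', hk', h, hf⟩
        exact ⟨k', hk', h, (h1 k' hk' h).1 hf⟩
      · rintro ⟨k', hk', h, hf⟩
        exact ⟨k', hk', h, (h1 k' hk' h).2 hf⟩

lemma inv_sqrt_two_pow_sq (k : ℕ) : ((√2)⁻¹ ^ k) ^ 2 = (2 : ℝ)⁻¹ ^ k := by
  rw [← pow_mul, mul_comm, pow_mul, inv_pow, Real.sq_sqrt two_pos.le]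

lemma Gate.apply_H_of_notMem {q : Qubit} {S : Finset Qubit} (hq : q ∉ S) (a : ℂ) :
    (Gate.H q).apply (Finsupp.single S a) = Finsupp.single S (a * ((√2 : ℝ) : ℂ)⁻¹) +
      Finsupp.single (insert q S) (a * ((√2 : ℝ) : ℂ)⁻¹) := by
  rw [Gate.apply_single, Gate.onBasis, if_neg hq, smul_add, Finsupp.smul_single,
    Finsupp.smul_single, Finset.erase_eq_of_notMem hq]
  rfl

lemma Gate.apply_H_insert {q : Qubit} {S : Finset Qubit} (hq : q ∉ S) (a : ℂ) :
    (Gate.H q).apply (Finsupp.single (insert q S) a) = Finsupp.single S (a * ((√2 : ℝ) : ℂ)⁻¹) -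
      Finsupp.single (insert q S) (a * ((√2 : ℝ) : ℂ)⁻¹) := by
  rw [Gate.apply_single, Gate.onBasis, if_pos (Finset.mem_insert_self _ _), smul_add,
    Finsupp.smul_single, Finsupp.smul_single, Finset.erase_insert hq, Finset.insert_idem, smul_neg,
    Finsupp.single_neg, ← sub_eq_add_neg]
  rfl

/-- Hadamard gates on fresh qubits produce a uniform superposition. -/
lemma Circuit.run_map_H {l : List Qubit} (hl : l.Nodup) {S : Finset Qubit} (hS : ∀ q ∈ l, q ∉ S)
    (a : ℂ) :
    Circuit.run (l.map Gate.H) (Finsupp.single S a) =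
      ∑ G ∈ l.toFinset.powerset, Finsupp.single (S ∪ G) (a * (((√2)⁻¹ ^ l.length : ℝ) : ℂ)) := by
  induction l generalizing S a with
  | nil => simp [Circuit.run]
  | cons q l ih =>
    rw [List.nodup_cons] at hl
    simp only [List.forall_mem_cons] at hS
    have hq : q ∉ l.toFinset := by simpa using hl.1
    simp only [List.map_cons, Circuit.run, LinearMap.comp_apply, Gate.apply_H_of_notMem hS.1,
      map_add]
    rw [ih hl.2 hS.2, ih hl.2 (fun q' hq' => ?_), List.toFinset_cons, Finset.sum_powerset_insert hq]
    · have e : a * ((√2 : ℝ) : ℂ)⁻¹ * (((√2)⁻¹ ^ l.length : ℝ) : ℂ) =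
          a * (((√2)⁻¹ ^ (q :: l).length : ℝ) : ℂ) := by
        rw [List.length_cons, pow_succ]
        push_cast
        ring
      rw [e]
      congr 1
      refine Finset.sum_congr rfl fun G _ => ?_
      rw [Finset.union_insert, Finset.insert_union]
    · rw [Finset.mem_insert, not_or]
      exact ⟨fun h => hl.1 (h ▸ hq'), hS.2 q' hq'⟩

end Classical

/-! ### The circuit that prepares flagged states -/

section Preparation

/-- The cells of a table with `t` rows and columns `0, …, m`, in the order in which the loops of the
program run through them. -/
def cells (t m : ℕ) : List (ℕ × ℕ) :=
  (List.range t).reverse.flatMap fun j => (List.range (m + 1)).reverse.map fun c => (j, c)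

lemma mem_cells {t m : ℕ} (k : ℕ × ℕ) : k ∈ cells t m ↔ k.1 < t ∧ k.2 ≤ m := by
  obtain ⟨j, c⟩ := k
  simp [cells]

lemma nodup_cells (t m : ℕ) : (cells t m).Nodup := by
  unfold cells
  rw [List.nodup_flatMap]
  constructor
  · intro j _
    exact (List.nodup_reverse.2 List.nodup_range).map fun c c' h => (Prod.ext_iff.1 h).2
  · refine (List.nodup_reverse.2 List.nodup_range).imp fun {j j'} hj => ?_
    simp only [Function.onFun, List.disjoint_left]
    intro k hk hk'
    obtain ⟨c, -, rfl⟩ := List.mem_map.1 hk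
    obtain ⟨c', -, h⟩ := List.mem_map.1 hk'
    exact hj (Prod.ext_iff.1 h).1.symm

lemma length_cells (t m : ℕ) : (cells t m).length = t * (m + 1) := by
  simp [cells]

/-- Row `j` of register `R` holds the bit string `w j`. -/
def registerBasis (R : ℕ) {t n : ℕ} (w : Fin t → Bits n) : Finset Qubit :=
  (inputBasis w).image fun q => (R, q.2)

lemma mem_registerBasis (R : ℕ) {t n : ℕ} (w : Fin t → Bits n) (q : Qubit) :
    q ∈ registerBasis R w ↔ ∃ j c, w j c = true ∧ q = (R, (j : ℕ), (c : ℕ)) := by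
  simp only [registerBasis, Finset.mem_image, mem_inputBasis]
  grind

lemma mk_mem_registerBasis (R : ℕ) {t n : ℕ} (x : Fin t → Bits n) (r j c : ℕ) :
    (r, j, c) ∈ registerBasis R x ↔
      r = R ∧ ∃ (hj : j < t) (hc : c < n), x ⟨j, hj⟩ ⟨c, hc⟩ = true := by
  rw [mem_registerBasis]
  simp only [Prod.mk.injEq]
  constructor
  · rintro ⟨j, c, h, rfl, rfl, rfl⟩
    exact ⟨rfl, j.2, c.2, h⟩
  · rintro ⟨rfl, hj, hc, h⟩
    exact ⟨_, _, h, rfl, rfl, rfl⟩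

/-- Hadamard gates superpose all subsets of a register; reindexing these by bit tables `w` exhibits
the coin tosses row by row. -/
lemma sum_powerset_register {M : Type*} [AddCommMonoid M] (R t m : ℕ) (F : Finset Qubit → M) :
    ∑ G ∈ ((cells t m).map fun k => ((R, k) : Qubit)).toFinset.powerset, F G =
      ∑ w : Fin t → Bits (m + 1), F (registerBasis R w) := by
  symm
  refine Finset.sum_bij' (fun w _ => registerBasis R w)
    (fun G _ j c => decide ((R, (j : ℕ), (c : ℕ)) ∈ G)) ?_ ?_ ?_ ?_ ?_
  · intro w _
    rw [Finset.mem_powerset]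
    intro q hq
    obtain ⟨j, c, -, rfl⟩ := (mem_registerBasis R w q).1 hq
    simp only [List.mem_toFinset, List.mem_map]
    exact ⟨_, (mem_cells _).2 ⟨j.2, Nat.lt_succ_iff.1 c.2⟩, rfl⟩
  · simp
  · intro w _
    ext j c
    simp only [mem_registerBasis, Prod.mk.injEq, true_and, Fin.val_inj]
    rw [Bool.eq_iff_iff]
    grind
  · intro G hG
    rw [Finset.mem_powerset] at hG
    ext q
    simp only [mem_registerBasis, decide_eq_true_eq]
    constructor
    · rintro ⟨j, c, h, rfl⟩
      exact h
    · intro hq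
      have := hG hq
      simp only [List.mem_toFinset, List.mem_map] at this
      obtain ⟨k, hk, rfl⟩ := this
      obtain ⟨h1, h2⟩ := (mem_cells k).1 hk
      exact ⟨⟨k.1, h1⟩, ⟨k.2, Nat.lt_succ_iff.2 h2⟩, hq, rfl⟩
  · simp

/-- Controlled on the qubit `(R, j, m)`, the qubit `(0, j, c)` is moved to `(R + 1, j, c)` and
replaced by `(R, j, c)`; for `c = m` the flag is written instead. -/
def prepBlock (b : Bool) (R m : ℕ) (k : ℕ × ℕ) : Circuit :=
  if k.2 = m then
    Gate.CX (R, k.1, m) (0, k.1, m) :: (if b then [Gate.X (0, k.1, m)] else [])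
  else
    [Gate.CCX (R, k.1, m) (0, k) (R + 1, k), Gate.CCX (R, k.1, m) (R + 1, k) (0, k),
      Gate.CCX (R, k.1, m) (R, k) (0, k)]

/-- Register `R` has no owner: the blocks only read the coins, and all blocks of row `j` share the
control `(R, j, m)`. -/
def prepOwner (R : ℕ) (q : Qubit) : Option (ℕ × ℕ) :=
  if q.1 = 0 ∨ q.1 = R + 1 then some q.2 else none

/-- Negated equivalences are exclusive ors. The formula allows any content of register `R + 1`; on
the actual input that register is empty, so the coin replaces the old bit, which is kept in `R + 1`
for reversibility. -/
def prepAction (b : Bool) (R m : ℕ) (k : ℕ × ℕ) (S : Finset Qubit) (p : Qubit) : Prop :=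
  if k.2 = m then
    if p = (0, k) then ¬ (p ∈ S ↔ ((R, k.1, m) ∈ S ↔ b = false)) else p ∈ S
  else if (R, k.1, m) ∈ S then
    if p = (0, k) then ¬ ((R + 1, k) ∈ S ↔ (R, k) ∈ S)
    else if p = (R + 1, k) then ¬ ((R + 1, k) ∈ S ↔ (0, k) ∈ S)
    else p ∈ S
  else p ∈ S

end Preparation

section Preparation

lemma mem_toggle_prepBlock (b : Bool) {R : ℕ} (hR : R ≠ 0) (m : ℕ) (k : ℕ × ℕ) (S : Finset Qubit)
    (p : Qubit) :
    p ∈ (prepBlock b R m k).toggle S ↔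
      if prepOwner R p = some k then prepAction b R m k S p else p ∈ S := by
  obtain ⟨j, c⟩ := k
  have h1 : prepOwner R p = some (j, c) ↔ p = (0, j, c) ∨ p = (R + 1, j, c) := by
    obtain ⟨r, k⟩ := p
    simp only [prepOwner]
    split_ifs <;> simp <;> grind
  rw [if_congr h1 rfl rfl]
  have n1 (j' c') : ((R, j', c') : Qubit) ≠ (0, j, c) := by simp [hR]
  have n2 (j' c') : ((R, j', c') : Qubit) ≠ (R + 1, j, c) := by simp
  have n3 : ((R + 1, j, c) : Qubit) ≠ (0, j, c) := by simp
  simp only [prepBlock, prepAction]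
  by_cases hc : c = m
  · subst hc
    simp only [if_true]
    cases b
    · simp only [Circuit.toggle, List.foldl, mem_toggle_CX (n1 _ _), Bool.false_eq_true, if_false]
      grind
    · simp only [Circuit.toggle, List.foldl, mem_toggle_CX (n1 _ _), if_true, mem_toggle_X]
      grind
  · simp only [hc, if_false, Circuit.toggle, List.foldl, mem_toggle_CCX (n1 j m) (n1 j c),
      mem_toggle_CCX (n1 j m) n3, mem_toggle_CCX (n2 j m) n3.symm, n1, n2, n3.symm, if_true]
    grind

lemma mem_toggle_prep (b : Bool) {R : ℕ} (hR : R ≠ 0) (t m : ℕ) (S : Finset Qubit) (p : Qubit) :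
    p ∈ Circuit.toggle ((cells t m).flatMap (prepBlock b R m)) S ↔
      if p.2 ∈ cells t m ∧ (p.1 = 0 ∨ p.1 = R + 1) then prepAction b R m p.2 S p else p ∈ S := by
  rw [Circuit.mem_toggle_flatMap (prepOwner R) (prepBlock b R m) (prepAction b R m)
    (mem_toggle_prepBlock b hR m) ?_ (nodup_cells t m)]
  · have h1 (k : ℕ × ℕ) : prepOwner R p = some k ↔ (p.1 = 0 ∨ p.1 = R + 1) ∧ p.2 = k := by
      unfold prepOwner
      split_ifs with h <;> simp [h]
    simp only [h1]
    grind
  · intro k S S' h p hp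
    replace hp : p = (0, k) ∨ p = (R + 1, k) := by
      obtain ⟨r, k'⟩ := p
      simp only [prepOwner] at hp
      split_ifs at hp
      grind
    have ho (q : Qubit) (hq : q = (0, k) ∨ q = (R + 1, k)) : q ∈ S ↔ q ∈ S' := by
      refine h q (Or.inl ?_)
      rcases hq with rfl | rfl <;> simp [prepOwner]
    have hn (j c : ℕ) : (R, j, c) ∈ S ↔ (R, j, c) ∈ S' :=
      h _ (Or.inr (by simp [prepOwner, hR]))
    have hn' : (R, k) ∈ S ↔ (R, k) ∈ S' := hn _ _
    simp only [prepAction, hn k.1 m, hn', ho p hp, ho _ (Or.inl rfl), ho _ (Or.inr rfl)]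

/-- The rows of register `0` after the preparation with random bits `w`. -/
def prepOut (b : Bool) {t m : ℕ} (x : Fin t → Bits m) (w : Fin t → Bits (m + 1)) :
    Fin t → Bits (m + 1) := fun j =>
  snocBit (fun c => if w j (Fin.last m) then w j c.castSucc else x j c) (w j (Fin.last m) ^^ b)

/-- The other qubits after the preparation. -/
def prepGarbage (R : ℕ) {t m : ℕ} (x : Fin t → Bits m) (w : Fin t → Bits (m + 1)) :
    Finset Qubit :=
  registerBasis R w ∪ registerBasis (R + 1) fun j c => w j (Fin.last m) && x j c

lemma toggle_prep (b : Bool) {R : ℕ} (hR : R ≠ 0) {t m : ℕ} (x : Fin t → Bits m)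
    (w : Fin t → Bits (m + 1)) :
    Circuit.toggle ((cells t m).flatMap (prepBlock b R m)) (inputBasis x ∪ registerBasis R w) =
      inputBasis (prepOut b x w) ∪ prepGarbage R x w := by
  ext ⟨r, j, c⟩
  rw [mem_toggle_prep b hR]
  simp only [mem_cells, prepAction, prepGarbage, Finset.mem_union, mk_mem_inputBasis, mk_mem_registerBasis,
     Prod.mk.injEq]
  by_cases hj : j < t
  · have e1 : ∀ hc : m < m + 1, (⟨m, hc⟩ : Fin (m + 1)) = Fin.last m := fun _ => rfl
    have o1 : prepOut b x w ⟨j, hj⟩ (Fin.last m) = (w ⟨j, hj⟩ (Fin.last m) ^^ b) := snocBit_last _ _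
    have o2 (hc : c < m) : prepOut b x w ⟨j, hj⟩ ⟨c, hc.trans m.lt_succ_self⟩ =
        if w ⟨j, hj⟩ (Fin.last m) then w ⟨j, hj⟩ ⟨c, hc.trans m.lt_succ_self⟩ else x ⟨j, hj⟩ ⟨c, hc⟩ :=
      snocBit_castSucc _ _ ⟨c, hc⟩
    rcases lt_trichotomy c m with hc | rfl | hc
    · have hc' := hc.trans m.lt_succ_self
      simp only [hj, hc, hc', hc.le, hc.ne, e1, o2 hc, exists_true_left, if_false, true_and, and_true,
        Nat.lt_succ_self]
      grind
    · simp only [hj, e1, o1, exists_true_left, true_and, and_true, le_refl, lt_irrefl,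
        Nat.lt_succ_self, if_true]
      grind
    · have h1 : ¬ c < m + 1 := by omega
      have h2 : ¬ c < m := by omega
      have h3 : ¬ c ≤ m := by omega
      simp [h1, h2, h3]
  · simp [hj]

end Preparation

/-! ### The prepared mixture is the flagged state -/

section Simulation

/-- Turns `t` copies of an `m`-qubit state into `t` copies of a flagged state on `m + 1` qubits. -/
def prepCircuit (b : Bool) (R t m : ℕ) : Circuit :=
  (cells t m).map (fun k => Gate.H ((R, k) : Qubit)) ++ (cells t m).flatMap (prepBlock b R m)

lemma isClassical_prepBlock (b : Bool) (R m : ℕ) (k : ℕ × ℕ) :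
    ∀ g ∈ prepBlock b R m k, g.IsClassical := by
  unfold prepBlock
  split_ifs <;> simp [Gate.IsClassical]

lemma run_prepCircuit (b : Bool) {R : ℕ} (hR : R ≠ 0) {t m : ℕ} (x : Fin t → Bits m) :
    (prepCircuit b R t m).run (Finsupp.single (inputBasis x) 1) =
      ∑ w, Finsupp.single (inputBasis (prepOut b x w) ∪ prepGarbage R x w)
        (((√2)⁻¹ ^ (t * (m + 1)) : ℝ) : ℂ) := by
  have h1 : (cells t m).map (fun k => Gate.H ((R, k) : Qubit)) =
      ((cells t m).map fun k => ((R, k) : Qubit)).map Gate.H := by simp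
  rw [prepCircuit, Circuit.run_append, h1, Circuit.run_map_H, sum_powerset_register, map_sum,
    List.length_map, length_cells]
  · refine Finset.sum_congr rfl fun w _ => ?_
    rw [Circuit.run_single_of_isClassical, toggle_prep b hR, one_mul]
    intro g hg
    obtain ⟨k, -, hk⟩ := List.mem_flatMap.1 hg
    exact isClassical_prepBlock _ _ _ _ g hk
  · exact (nodup_cells t m).map fun k k' h => (Prod.ext_iff.1 h).2
  · intro q hq h
    obtain ⟨k, -, rfl⟩ := List.mem_map.1 hq
    obtain ⟨j, c, -, h⟩ := (mem_inputBasis x _).1 h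
    exact hR (Prod.ext_iff.1 h).1

/-- The garbage records all coins, and the input only in the rows whose control coin is `1`. Hence
the coherence of `ψ` survives exactly in the rows with control coin `0`. -/
lemma prepGarbage_eq_iff {R t m : ℕ} (x y : Fin t → Bits m) (w w' : Fin t → Bits (m + 1)) :
    prepGarbage R x w = prepGarbage R y w' ↔
      ∀ j, w j = w' j ∧ (w j (Fin.last m) = true → x j = y j) := by
  have h1 (x : Fin t → Bits m) (w : Fin t → Bits (m + 1)) (j : Fin t) (c : Fin (m + 1)) :
      (R, (j : ℕ), (c : ℕ)) ∈ prepGarbage R x w ↔ w j c = true := by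
    simp [prepGarbage, mem_registerBasis, Fin.val_inj]
  have h2 (x : Fin t → Bits m) (w : Fin t → Bits (m + 1)) (j : Fin t) (c : Fin m) :
      (R + 1, (j : ℕ), (c : ℕ)) ∈ prepGarbage R x w ↔ w j (Fin.last m) = true ∧ x j c = true := by
    simp [prepGarbage, mem_registerBasis, Fin.val_inj]
  constructor
  · intro h j
    have hw : w j = w' j := by
      ext c
      rw [Bool.eq_iff_iff, ← h1 x w, ← h1 y w', h]
    refine ⟨hw, fun hj => ?_⟩
    ext c
    have h3 := h2 x w j c
    rw [h, h2, ← hw] at h3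
    rw [Bool.eq_iff_iff]
    simpa [hj] using h3.symm
  · intro h
    have hw : w = w' := funext fun j => (h j).1
    subst hw
    unfold prepGarbage
    congr 2
    ext j c
    cases hj : w j (Fin.last m)
    · simp
    · rw [(h j).2 hj]

lemma sum_prod_four {T : ℕ} {α β γ δ M : Type*} [Fintype α] [Fintype β] [Fintype γ] [Fintype δ]
    [CommSemiring M] (g : Fin T → α → β → γ → δ → M) :
    ∏ j, ∑ x, ∑ y, ∑ w, ∑ w', g j x y w w' =
      ∑ x : Fin T → α, ∑ y : Fin T → β, ∑ w : Fin T → γ, ∑ w' : Fin T → δ,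
        ∏ j, g j (x j) (y j) (w j) (w' j) := by
  classical
  simp only [Finset.prod_univ_sum, Fintype.piFinset_univ]

/-- The preparation of one row. -/
lemma flagState_apply_eq_sum (b : Bool) {m : ℕ} (ψ : PureState m) (X Y : Bits (m + 1)) :
    flagState b ψ X Y = ∑ x : Bits m, ∑ y : Bits m, ∑ w : Bits (m + 1), ∑ w' : Bits (m + 1),
      if (w = w' ∧ (w (Fin.last m) = true → x = y)) ∧
        X = snocBit (fun c => if w (Fin.last m) then w c.castSucc else x c)
          (w (Fin.last m) ^^ b) ∧
        Y = snocBit (fun c => if w' (Fin.last m) then w' c.castSucc else y c)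
          (w' (Fin.last m) ^^ b) then (2 : ℂ)⁻¹ ^ (m + 1) * ketbra ψ x y else 0 := by
  have hsn (Z : Bits (m + 1)) (c : Bits m) (e : Bool) :
      Z = snocBit c e ↔ (fun i => Z i.castSucc) = c ∧ Z (Fin.last m) = e := by
    constructor
    · rintro rfl
      simp
    · rintro ⟨rfl, rfl⟩
      ext i
      refine Fin.lastCases ?_ (fun i => ?_) i <;> simp
  set X₀ : Bits m := fun i => X i.castSucc with hX₀
  set Y₀ : Bits m := fun i => Y i.castSucc with hY₀
  have h1 (x y : Bits m) (w : Bits (m + 1)) : (∑ w' : Bits (m + 1),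
      if (w = w' ∧ (w (Fin.last m) = true → x = y)) ∧
        X = snocBit (fun c => if w (Fin.last m) then w c.castSucc else x c)
          (w (Fin.last m) ^^ b) ∧
        Y = snocBit (fun c => if w' (Fin.last m) then w' c.castSucc else y c)
          (w' (Fin.last m) ^^ b) then (2 : ℂ)⁻¹ ^ (m + 1) * ketbra ψ x y else 0) =
      if (w (Fin.last m) = true → x = y) ∧
        X = snocBit (fun c => if w (Fin.last m) then w c.castSucc else x c)
          (w (Fin.last m) ^^ b) ∧
        Y = snocBit (fun c => if w (Fin.last m) then w c.castSucc else y c)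
          (w (Fin.last m) ^^ b) then (2 : ℂ)⁻¹ ^ (m + 1) * ketbra ψ x y else 0 := by
    rw [Finset.sum_eq_single w]
    · simp
    · intro w' _ hw'
      simp [hw'.symm]
    · simp
  -- Split by the control coin. For `0` the input passes through and the `m` idle coins give `2^m *
  -- 2^(-(m+1)) = 1/2`. For `1` the input is traced out, with trace `1`, and the coins written to
  -- the output form `1/2 * I / 2^m`.
  simp_rw [h1, sum_snocBit _ false]
  simp only [snocBit_last, snocBit_castSucc, Bool.false_eq_true, false_imp_iff, true_and, if_false,
    Bool.not_false, if_true, true_imp_iff, hsn]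
  simp_rw [Finset.sum_add_distrib]
  have htr : ∑ x : Bits m, ketbra ψ x x = 1 := trace_ketbra ψ
  have h2 : (2 : ℂ) ^ m ≠ 0 := by positivity
  rw [flagState, Matrix.add_apply, Matrix.smul_apply, Matrix.smul_apply]
  congr 1
  · simp only [flagged, Matrix.of_apply, Bool.false_bne]
    by_cases hx : X (Fin.last m) = b <;> by_cases hy : Y (Fin.last m) = b <;>
      simp [hx, hy, ite_and, ← hX₀, ← hY₀]
    field_simp
    ring
  · simp only [flagged, Matrix.of_apply, Bool.true_bne]
    by_cases hx : X (Fin.last m) = !b <;> by_cases hy : Y (Fin.last m) = !b <;>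
      simp [hx, hy, ite_and, ← hX₀, ← hY₀, maxMixed, Matrix.one_apply]
    rw [← Finset.mul_sum, htr, pow_succ, mul_inv, mul_one, mul_comm]
    exact if_congr eq_comm rfl rfl

/-- All garbage lies in the registers `R` and `R + 1`, out of reach of `C`; `2 ≤ R` keeps the input
register `0` and the output register `1` apart from it. -/
lemma acceptProb_prepCircuit_append (b : Bool) {R : ℕ} (hR : 2 ≤ R) {t m : ℕ} {C : Circuit}
    (hC : ∀ g ∈ C, g.On fun q => q.1 < R) (ψ : PureState m) :
    acceptProb (prepCircuit b R t m ++ C) (tensorPow t (ketbra ψ)) =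
      acceptProb C (tensorPow t (flagState b ψ)) := by
  refine acceptProb_append (P := fun q => q.1 < R) (by simp [outQubit]; omega)
    (fun j c => by simp; omega) hC (prepOut b) (prepGarbage R) ?_ _
    (run_prepCircuit b (by omega)) _ _ ?_
  · intro x w q hq
    simp only [prepGarbage, Finset.mem_union, mem_registerBasis] at hq
    grind
  · intro X Y
    simp only [tensorPow, Matrix.of_apply, flagState_apply_eq_sum]
    rw [sum_prod_four]
    refine Finset.sum_congr rfl fun x _ => Finset.sum_congr rfl fun y _ =>
      Finset.sum_congr rfl fun w _ => Finset.sum_congr rfl fun w' _ => ?_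
    rw [Fintype.prod_ite_zero]
    have hcond : (∀ j, (w j = w' j ∧ (w j (Fin.last m) = true → x j = y j)) ∧
        X j = snocBit (fun c => if w j (Fin.last m) then w j c.castSucc else x j c)
          (w j (Fin.last m) ^^ b) ∧
        Y j = snocBit (fun c => if w' j (Fin.last m) then w' j c.castSucc else y j c)
          (w' j (Fin.last m) ^^ b)) ↔
        prepGarbage R x w = prepGarbage R y w' ∧ X = prepOut b x w ∧ Y = prepOut b y w' := by
      rw [prepGarbage_eq_iff, forall_and, forall_and (p := fun j => X j = _), funext_iff, funext_iff]
      rfl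
    by_cases h : prepGarbage R x w = prepGarbage R y w' ∧ X = prepOut b x w ∧ Y = prepOut b y w'
    swap
    · rw [if_neg h, if_neg (hcond.not.2 h)]
    rw [if_pos h, if_pos (hcond.2 h)]
    rw [Finset.prod_mul_distrib, Fin.prod_const, ← pow_mul, ← Complex.ofReal_pow,
      inv_sqrt_two_pow_sq, mul_comm t]
    push_cast
    rfl

end Simulation

/-! ### Programs that write the simulating circuits -/

section Programs

/-- All gates that the program emits act on registers below `R`. -/
def Prog.RegistersLT (R : ℕ) : Prog → Prop
  | .emit g => g.On fun q => q.1 < R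
  | .seq p q => p.RegistersLT R ∧ q.RegistersLT R
  | .while _ p => p.RegistersLT R
  | _ => True

lemma Prog.RegistersLT.mono {R R' : ℕ} (h : R ≤ R') {p : Prog} (hp : p.RegistersLT R) :
    p.RegistersLT R' :=
  match p, hp with
  | .emit _, hp => Gate.On.mono (fun _ hq => lt_of_lt_of_le hq h) hp
  | .seq _ _, hp => ⟨hp.1.mono h, hp.2.mono h⟩
  | .while _ q, hp => RegistersLT.mono h (p := q) hp
  | .inc _, _ | .dec _, _ | .copy _ _, _ | .load _ _, _ | .store _ _, _ => trivial

lemma Gate.exists_on_registersLT (g : Gate (ℕ × ℕ × ℕ)) : ∃ R, g.On fun q => q.1 < R := by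
  cases g with
  | H q => exact ⟨q.1 + 1, Nat.lt_succ_self _⟩
  | T q => exact ⟨q.1 + 1, Nat.lt_succ_self _⟩
  | X q => exact ⟨q.1 + 1, Nat.lt_succ_self _⟩
  | CX a q => exact ⟨a.1 + q.1 + 1, by constructor <;> omega⟩
  | CCX a b q => exact ⟨a.1 + b.1 + q.1 + 1, by refine ⟨?_, ?_, ?_⟩ <;> omega⟩

/-- Register numbers are constants in the program text, so a single bound serves all input sizes,
and fresh registers for garbage always exist. -/
lemma Prog.exists_registersLT : ∀ p : Prog, ∃ R, p.RegistersLT R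
  | .emit _ => Gate.exists_on_registersLT _
  | .seq p q =>
    have ⟨R, hR⟩ := p.exists_registersLT
    have ⟨R', hR'⟩ := q.exists_registersLT
    ⟨max R R', hR.mono (le_max_left _ _), hR'.mono (le_max_right _ _)⟩
  | .while _ p => p.exists_registersLT
  | .inc _ | .dec _ | .copy _ _ | .load _ _ | .store _ _ => ⟨0, trivial⟩

lemma Exec.on_of_registersLT {R : ℕ} {p : Prog} {σ σ' : Mem} {C : Circuit} {τ : ℕ}
    (h : Exec p σ C σ' τ) (hp : p.RegistersLT R) : ∀ g ∈ C, g.On fun q => q.1 < R := by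
  induction h with
  | emit g σ =>
    intro g' hg'
    rw [List.mem_singleton] at hg'
    subst hg'
    exact Gate.On.map (P := fun q : ℕ × ℕ × ℕ => q.1 < R) (f := σ.qubit)
      (fun q hq => hq) hp
  | seq _ _ ih₁ ih₂ =>
    intro g hg
    exact (List.mem_append.1 hg).elim (ih₁ hp.1 g) (ih₂ hp.2 g)
  | while_step _ _ _ ih₁ ih₂ =>
    intro g hg
    exact (List.mem_append.1 hg).elim (ih₁ hp g) (ih₂ hp g)
  | _ => simp

/-- Emit a list of gates. -/
def Prog.emits : List (Gate (ℕ × ℕ × ℕ)) → Prog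
  -- A no-op of cost one, which accounts for the `+ 1` in the running time.
  | [] => .copy 0 0
  | g :: l => .seq (.emit g) (Prog.emits l)

lemma Exec.emits (l : List (Gate (ℕ × ℕ × ℕ))) (σ : Mem) :
    Exec (Prog.emits l) σ (l.map fun g => g.map σ.qubit) σ (l.length + 1) := by
  induction l with
  | nil => simpa [Prog.emits] using Exec.copy 0 0 σ
  | cons g l ih =>
    have := (Exec.emit g σ).seq ih
    rw [add_comm 1] at this
    exact this

/-- Run `p` with the cell `i` counting down to `0`. -/
def Prog.countdown (i : ℕ) (p : Prog) : Prog := .while i (.seq (.dec i) p)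

/-- The counter is decremented before the body runs, so the body sees `n - 1, …, 0`; this is why
ranges are reversed here and in `cells`. -/
lemma Exec.countdown {i : ℕ} {p : Prog} {σ : Mem} {B : ℕ → Circuit} {τ : ℕ}
    (h : ∀ c, Exec p (Function.update σ i c) (B c) (Function.update σ i c) τ) (n : ℕ) :
    Exec (Prog.countdown i p) (Function.update σ i n) ((List.range n).reverse.flatMap B)
      (Function.update σ i 0) (n * (τ + 2) + 1) := by
  induction n with
  | zero => simpa [Prog.countdown] using Exec.while_done (p := .seq (.dec i) p) (by simp)
  | succ n ih =>
    have h1 : Exec (.dec i) (Function.update σ i (n + 1)) [] (Function.update σ i n) 1 := by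
      simpa using Exec.dec i (Function.update σ i (n + 1))
    have h2 := Exec.while_step (i := i) (by simp) (h1.seq (h n)) ih
    rw [List.range_succ, List.reverse_append, List.reverse_singleton, List.singleton_append,
      List.flatMap_cons]
    have e : (n + 1) * (τ + 2) + 1 = 1 + (1 + τ) + (n * (τ + 2) + 1) := by ring
    rw [e]
    exact h2

/-- For each row, emit `E₁` and then, for each column, emit `E₂`. The row is counted in cell `3` and
the column in cell `4`. -/
def Prog.tableLoop (E₁ E₂ : List (Gate (ℕ × ℕ × ℕ))) : Prog :=
  .seq (.copy 3 1) (.countdown 3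
    (.seq (.emits E₁) (.seq (.copy 4 0) (.countdown 4 (.emits E₂)))))

lemma flatMap_cells (t m : ℕ) (f : ℕ × ℕ → Circuit) :
    (cells t m).flatMap f = (List.range t).reverse.flatMap fun j =>
      f (j, m) ++ (List.range m).reverse.flatMap fun c => f (j, c) := by
  simp [cells, List.flatMap_assoc, List.range_succ, -List.map_reverse, List.flatMap_map]

/-- The flag column `m` is handled by `E₁`, whose operands can read `m` from cell `0`. The counters
end at `0`, so the initial memory is restored and table loops can be chained. -/
lemma Exec.tableLoop {E₁ E₂ : List (Gate (ℕ × ℕ × ℕ))} {t m : ℕ} {f : ℕ × ℕ → Circuit}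
    (h₁ : ∀ j, E₁.map (fun g => g.map (Mem.qubit (Function.update (initMem m t) 3 j))) = f (j, m))
    (h₂ : ∀ j c, c < m → E₂.map (fun g => g.map
      (Mem.qubit (Function.update (Function.update (initMem m t) 3 j) 4 c))) = f (j, c)) :
    Exec (Prog.tableLoop E₁ E₂) (initMem m t) ((cells t m).flatMap f) (initMem m t)
      (t * (E₁.length + m * (E₂.length + 3) + 5) + 2) := by
  set σ := initMem m t with hσ
  have h3 : Function.update σ 3 0 = σ := by simp [hσ, initMem]
  have hbody (j : ℕ) : Exec
      (.seq (.emits E₁) (.seq (.copy 4 0) (.countdown 4 (.emits E₂)))) (Function.update σ 3 j)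
      (f (j, m) ++ (List.range m).reverse.flatMap fun c => f (j, c)) (Function.update σ 3 j)
      ((E₁.length + 1) + (1 + (m * (E₂.length + 1 + 2) + 1))) := by
    have e1 := Exec.emits E₁ (Function.update σ 3 j)
    rw [h₁] at e1
    refine e1.seq ?_
    have e2 : Exec (.copy 4 0) (Function.update σ 3 j) []
        (Function.update (Function.update σ 3 j) 4 m) 1 := by
      have := Exec.copy 4 0 (Function.update σ 3 j)
      simpa [hσ, initMem] using this
    have e3 := Exec.countdown (i := 4) (p := .emits E₂) (σ := Function.update σ 3 j)
      (fun c => Exec.emits E₂ (Function.update (Function.update σ 3 j) 4 c)) m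
    have e4 : Function.update (Function.update σ 3 j) 4 0 = Function.update σ 3 j := by
      rw [Function.update_eq_self_iff]
      simp [hσ, initMem]
    rw [e4] at e3
    have e5 : ((List.range m).reverse.flatMap fun c => E₂.map fun g => g.map
        (Mem.qubit (Function.update (Function.update σ 3 j) 4 c))) =
        (List.range m).reverse.flatMap fun c => f (j, c) := by
      refine List.flatMap_congr fun c hc => h₂ j c ?_
      simpa using hc
    rw [e5] at e3
    exact e2.seq e3
  have e0 : Exec (.copy 3 1) σ [] (Function.update σ 3 t) 1 := by
    have := Exec.copy 3 1 σ
    simpa [hσ, initMem] using this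
  have := e0.seq (Exec.countdown hbody t)
  rw [h3, List.nil_append, ← flatMap_cells] at this
  have e : t * (E₁.length + m * (E₂.length + 3) + 5) + 2 =
      1 + (t * (E₁.length + 1 + (1 + (m * (E₂.length + 1 + 2) + 1)) + 2) + 1) := by ring
  rw [e]
  exact this

/-- The gates of `prepBlock` in terms of the memory cells. -/
def prepFlagGates (b : Bool) (R : ℕ) : List (Gate (ℕ × ℕ × ℕ)) :=
  .CX (R, 3, 0) (0, 3, 0) :: if b then [.X (0, 3, 0)] else []

def prepColumnGates (R : ℕ) : List (Gate (ℕ × ℕ × ℕ)) :=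
  [.CCX (R, 3, 0) (0, 3, 4) (R + 1, 3, 4), .CCX (R, 3, 0) (R + 1, 3, 4) (0, 3, 4),
    .CCX (R, 3, 0) (R, 3, 4) (0, 3, 4)]

def Prog.prep (b : Bool) (R : ℕ) : Prog :=
  .seq (.tableLoop [.H (R, 3, 0)] [.H (R, 3, 4)])
    (.tableLoop (prepFlagGates b R) (prepColumnGates R))

lemma Exec.prep (b : Bool) (R t m : ℕ) : ∃ τ, τ ≤ t * (10 * m + 20) + 10 ∧
    Exec (Prog.prep b R) (initMem m t) (prepCircuit b R t m) (initMem m t) τ := by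
  have h1 : (cells t m).map (fun k => Gate.H ((R, k) : Qubit)) =
      (cells t m).flatMap fun k => [Gate.H ((R, k) : Qubit)] := by
    rw [List.map_eq_flatMap]
  rw [prepCircuit, h1]
  have hl : (prepFlagGates b R).length ≤ 2 := by
    cases b <;> simp [prepFlagGates]
  refine ⟨_, ?_, Exec.seq (Exec.tableLoop ?_ ?_) (Exec.tableLoop ?_ ?_)⟩
  · have := Nat.mul_le_mul_left t hl
    simp only [prepColumnGates, List.length_cons, List.length_nil]
    nlinarith
  · intro j
    simp [Gate.map, Mem.qubit, initMem]
  · intro j c _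
    simp [Gate.map, Mem.qubit]
  · intro j
    cases b <;> simp [prepFlagGates, prepBlock, Gate.map, Mem.qubit, initMem]
  · intro j c hc
    simp [prepColumnGates, prepBlock, Gate.map, Mem.qubit, initMem, hc.ne]

lemma ConventionalAlgorithm.exists_simulates (A : ConventionalAlgorithm) (b : Bool) :
    ∃ C, Simulates A b C := by
  obtain ⟨p, P, hp⟩ := A.polyTime
  obtain ⟨R₀, hR₀⟩ := p.exists_registersLT
  -- Beyond every register that `p` names, and beyond the registers `0` and `1`.
  set R := R₀ + 2
  have hR : p.RegistersLT R := hR₀.mono (by omega)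
  -- Cell `1` already holds `A.copies.eval (m + 1)`, so nothing has to be computed; `inc 0` turns
  -- `m` into the number of qubits that `p` expects.
  refine ⟨fun m => prepCircuit b R (A.copies.eval (m + 1)) m ++ A.circuit (m + 1),
    ⟨.seq (.prep b R) (.seq (.inc 0) p), A.copies.comp (Polynomial.X + 1) *
      (10 * Polynomial.X + 20) + 10 + (1 + P.comp (Polynomial.X + 1)), fun m => ?_⟩, fun m ψ => ?_⟩
  · obtain ⟨σ, τ, hE, hτ⟩ := hp (m + 1)
    obtain ⟨τ', hτ', hE'⟩ := Exec.prep b R (A.copies.eval (m + 1)) m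
    have hinc : Exec (.inc 0) (initMem m (A.copies.eval (m + 1))) []
        (initMem (m + 1) (A.copies.eval (m + 1))) 1 := by
      have := Exec.inc 0 (initMem m (A.copies.eval (m + 1)))
      convert this using 1
      ext i
      by_cases hi : i = 0 <;> simp [initMem, hi]
    refine ⟨σ, τ' + (1 + τ), ?_, ?_⟩
    · simpa using hE'.seq (hinc.seq hE)
    · simpa using by omega
  · obtain ⟨σ, τ, hE, hτ⟩ := hp (m + 1)
    have h1 := acceptProb_prepCircuit_append b (R := R) (by omega) (t := A.copies.eval (m + 1))
      (hE.on_of_registersLT hR) ψ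
    have h2 : (A.copies.comp (Polynomial.X + 1)).eval m = A.copies.eval (m + 1) := by simp
    rw [h2, h1, A.implements (m + 1) _ (posSemidef_flagState b ψ) (trace_flagState b ψ)]
    rfl

end Programs

/-! ### The swap test on two copies -/

section SwapTest

/-- The control qubit of the swap test. -/
def testQubit : Qubit := (2, 0, 0)

/-- Swap the qubits in column `c` of the rows `0` and `1`, controlled on the test qubit. -/
def swapBlock (c : ℕ) : Circuit :=
  [.CX (0, 1, c) (0, 0, c), .CCX testQubit (0, 0, c) (0, 1, c), .CX (0, 1, c) (0, 0, c)]

def swapColumns (m : ℕ) : Circuit := (List.range m).reverse.flatMap swapBlock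

/-- The swap test on the first `m` columns of two rows; the output is `1` if the test fails and the
flag (column `m`) of the first row is `1`. -/
def swapTest (m : ℕ) : Circuit :=
  .H testQubit :: (swapColumns m ++ [.H testQubit, .CCX testQubit (0, 0, m) outQubit])

/-- A swap is three exclusive ors. Controlling the middle one suffices, since the outer two cancel
when it does not act. -/
lemma mem_toggle_swapBlock (c : ℕ) (S : Finset Qubit) (p : Qubit) :
    p ∈ (swapBlock c).toggle S ↔
      if testQubit ∈ S ∧ p = (0, 0, c) then (0, 1, c) ∈ S
      else if testQubit ∈ S ∧ p = (0, 1, c) then (0, 0, c) ∈ S else p ∈ S := by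
  have n1 : ((0, 1, c) : Qubit) ≠ (0, 0, c) := by simp
  have n2 : testQubit ≠ (0, 0, c) := by simp [testQubit]
  have n3 : testQubit ≠ (0, 1, c) := by simp [testQubit]
  simp only [swapBlock, Circuit.toggle, List.foldl, mem_toggle_CX n1, mem_toggle_CCX n3 n1.symm, n1,
    n1.symm, n2, if_true, if_false]
  grind

lemma mem_toggle_swapColumns (m : ℕ) (S : Finset Qubit) (p : Qubit) :
    p ∈ (swapColumns m).toggle S ↔
      if testQubit ∈ S ∧ p.1 = 0 ∧ p.2.1 < 2 ∧ p.2.2 < m then (0, 1 - p.2.1, p.2.2) ∈ S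
      else p ∈ S := by
  rw [swapColumns, Circuit.mem_toggle_flatMap
    (fun p => if p.1 = 0 ∧ p.2.1 < 2 then some p.2.2 else none) swapBlock
    (fun c S p => p ∈ (swapBlock c).toggle S) ?_ ?_ (List.nodup_reverse.2 List.nodup_range)]
  · obtain ⟨r, j, c⟩ := p
    simp only [mem_toggle_swapBlock, List.mem_reverse, List.mem_range, Prod.mk.injEq]
    by_cases h : r = 0 ∧ j < 2
    · obtain ⟨rfl, hj⟩ := h
      interval_cases j <;> simp <;> grind
    · simp
      grind
  · intro c S p
    obtain ⟨r, j, c'⟩ := p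
    simp only [mem_toggle_swapBlock, Prod.mk.injEq]
    by_cases h : r = 0 ∧ j < 2
    · obtain ⟨rfl, hj⟩ := h
      interval_cases j <;> simp <;> grind
    · simp
      grind
  · intro c S S' h p hp
    have ht := h testQubit (Or.inr (by simp [testQubit]))
    have h0 := h (0, 0, c) (Or.inl (by simp))
    have h1 := h (0, 1, c) (Or.inl (by simp))
    simp only [mem_toggle_swapBlock, ht, h0, h1, h p (Or.inl hp)]

/-- Exchange the first `m` columns of the two rows. -/
def swapRows {m : ℕ} (x : Fin 2 → Bits (m + 1)) : Fin 2 → Bits (m + 1) := fun j =>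
  snocBit (fun c => x (1 - j) c.castSucc) (x j (Fin.last m))

lemma swapRows_swapRows {m : ℕ} (x : Fin 2 → Bits (m + 1)) : swapRows (swapRows x) = x := by
  ext j i
  refine Fin.lastCases ?_ (fun i => ?_) i <;> simp [swapRows]

lemma toggle_swapColumns_of_notMem {m : ℕ} {S : Finset Qubit} (h : testQubit ∉ S) :
    (swapColumns m).toggle S = S := by
  ext p
  rw [mem_toggle_swapColumns]
  simp [h]

lemma toggle_swapColumns_insert {m : ℕ} (x : Fin 2 → Bits (m + 1)) :
    (swapColumns m).toggle (insert testQubit (inputBasis x)) =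
      insert testQubit (inputBasis (swapRows x)) := by
  ext ⟨r, j, c⟩
  rw [mem_toggle_swapColumns]
  simp only [Finset.mem_insert, mk_mem_inputBasis, testQubit, Prod.mk.injEq, true_or, true_and]
  by_cases hj : r = 0 ∧ j < 2
  · obtain ⟨rfl, hj⟩ := hj
    have e1 : ∀ hc : m < m + 1, (⟨m, hc⟩ : Fin (m + 1)) = Fin.last m := fun _ => rfl
    have o1 : swapRows x ⟨j, hj⟩ (Fin.last m) = x ⟨j, hj⟩ (Fin.last m) := snocBit_last _ _
    have o2 (hc : c < m) : swapRows x ⟨j, hj⟩ ⟨c, hc.trans m.lt_succ_self⟩ =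
        x (1 - ⟨j, hj⟩) ⟨c, hc.trans m.lt_succ_self⟩ := snocBit_castSucc _ _ ⟨c, hc⟩
    have e2 : ∀ h : 1 - j < 2, (⟨1 - j, h⟩ : Fin 2) = 1 - ⟨j, hj⟩ := by
      intro h
      interval_cases j <;> rfl
    have h3 : 1 - j < 2 := by omega
    rcases lt_trichotomy c m with hc | rfl | hc
    · have hc' := hc.trans m.lt_succ_self
      simp [hj, hc, hc', o2 hc, e2, h3]
    · simp [hj, e1, o1]
    · have h1 : ¬ c < m + 1 := by omega
      simp [h1, hc.not_gt]
  · grind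

lemma run_swapTest {m : ℕ} (x : Fin 2 → Bits (m + 1)) :
    (swapTest m).run (Finsupp.single (inputBasis x) 1) =
      (1 / 2 : ℂ) • (Finsupp.single (inputBasis x) 1 + Finsupp.single (inputBasis (swapRows x)) 1 +
        (Finsupp.single ((if x 0 (Fin.last m) then {outQubit} else ∅) ∪
            insert testQubit (inputBasis x)) 1 -
          Finsupp.single ((if x 0 (Fin.last m) then {outQubit} else ∅) ∪
            insert testQubit (inputBasis (swapRows x))) 1)) := by
  have ht (y : Fin 2 → Bits (m + 1)) : testQubit ∉ inputBasis y := by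
    intro h
    obtain ⟨j, c, -, h⟩ := (mem_inputBasis y _).1 h
    simp [testQubit] at h
  have ho (y : Fin 2 → Bits (m + 1)) : outQubit ∉ insert testQubit (inputBasis y) := by
    rw [Finset.mem_insert, mem_inputBasis]
    simp [testQubit, outQubit]
  have hcl : ∀ g ∈ swapColumns m, g.IsClassical := by
    intro g hg
    obtain ⟨c, -, hg⟩ := List.mem_flatMap.1 hg
    simp only [swapBlock, List.mem_cons, List.not_mem_nil, or_false] at hg
    rcases hg with rfl | rfl | rfl <;> trivial
  have hccx : (Gate.CCX testQubit (0, 0, m) outQubit).IsClassical := trivial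
  have h1 (y : Fin 2 → Bits (m + 1)) (a : ℂ) :
      (Gate.CCX testQubit (0, 0, m) outQubit).apply (Finsupp.single (inputBasis y) a) =
        Finsupp.single (inputBasis y) a := by
    rw [Gate.apply_single_of_isClassical hccx, Gate.toggle, if_neg (by simp [ht y])]
  have h2 (y : Fin 2 → Bits (m + 1)) (a : ℂ) :
      (Gate.CCX testQubit (0, 0, m) outQubit).apply
          (Finsupp.single (insert testQubit (inputBasis y)) a) =
        Finsupp.single ((if y 0 (Fin.last m) then {outQubit} else ∅) ∪
          insert testQubit (inputBasis y)) a := by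
    rw [Gate.apply_single_of_isClassical hccx, Gate.toggle]
    congr 1
    have h3 : ((0, 0, m) : Qubit) ∈ insert testQubit (inputBasis y) ↔
        y 0 (Fin.last m) = true := by
      rw [Finset.mem_insert, mk_mem_inputBasis]
      have : ((0, 0, m) : Qubit) ≠ testQubit := by simp [testQubit]
      simp only [this, false_or, true_and]
      exact ⟨fun ⟨_, _, h⟩ => h, fun h => ⟨Nat.two_pos, m.lt_succ_self, h⟩⟩
    have h4 : testQubit ≠ outQubit := by simp [testQubit, outQubit]
    have h5 : ((0, 0, m) : Qubit) ≠ outQubit := by simp [outQubit]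
    by_cases hy : y 0 (Fin.last m) = true
    · rw [if_pos ⟨h4, h5, Finset.mem_insert_self _ _, h3.2 hy⟩, flipQubit, if_neg (ho y), if_pos hy]
      rfl
    · rw [if_neg fun h => hy (h3.1 h.2.2.2), if_neg hy, Finset.empty_union]
  have hs : swapRows x 0 (Fin.last m) = x 0 (Fin.last m) := snocBit_last _ _
  have hκ : ((√2 : ℝ) : ℂ)⁻¹ * ((√2 : ℝ) : ℂ)⁻¹ = 1 / 2 := by
    rw [← mul_inv, ← Complex.ofReal_mul, Real.mul_self_sqrt two_pos.le]
    norm_num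
  rw [swapTest, Circuit.run, LinearMap.comp_apply, Gate.apply_H_of_notMem (ht x),
    Circuit.run_append, map_add, Circuit.run_single_of_isClassical hcl,
    Circuit.run_single_of_isClassical hcl, toggle_swapColumns_of_notMem (ht x),
    toggle_swapColumns_insert]
  simp only [Circuit.run, LinearMap.comp_apply, LinearMap.id_apply, map_add, map_sub,
    Gate.apply_H_of_notMem (ht _), Gate.apply_H_insert (ht _), h1, h2, one_mul, hκ, hs, smul_add,
    smul_sub, Finsupp.smul_single, smul_eq_mul, mul_one]
  abel

lemma outForm_sub_left (u u' v : Ket) : outForm (u - u') v = outForm u v - outForm u' v := by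
  rw [sub_eq_add_neg, ← neg_one_smul ℂ, outForm_add_left, outForm_smul_left]
  ring

lemma outForm_sub_right (u v v' : Ket) : outForm u (v - v') = outForm u v - outForm u v' := by
  rw [sub_eq_add_neg, ← neg_one_smul ℂ, outForm_add_right, outForm_smul_right]
  simp [sub_eq_add_neg]

/-- Only the branch with test qubit `1` and first flag `1` reaches the output; it carries `(|x⟩ -
|swapRows x⟩) / 2`. As `swapRows` is an involution that fixes the flags, the four overlaps pair up.
-/
lemma outForm_swapTest {m : ℕ} (x y : Fin 2 → Bits (m + 1)) :
    outForm ((swapTest m).run (Finsupp.single (inputBasis x) 1))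
        ((swapTest m).run (Finsupp.single (inputBasis y) 1)) =
      if x 0 (Fin.last m) = true then
        (1 / 2) * ((if y = x then 1 else 0) - (if y = swapRows x then 1 else 0)) else 0 := by
  have h0 (y : Fin 2 → Bits (m + 1)) : outQubit ∉ inputBasis y := by
    rw [mem_inputBasis]
    simp [outQubit]
  have ht (y : Fin 2 → Bits (m + 1)) : testQubit ∉ inputBasis y := by
    rw [mem_inputBasis]
    simp [testQubit]
  have hto : testQubit ≠ outQubit := by simp [testQubit, outQubit]
  set B : Bool → (Fin 2 → Bits (m + 1)) → Finset Qubit := fun f y =>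
    (if f then {outQubit} else ∅) ∪ insert testQubit (inputBasis y) with hB
  have hmem (f y) : outQubit ∈ B f y ↔ f = true := by
    cases f <;> simp [hB, hto.symm, h0]
  have hne (f) (y y' : Fin 2 → Bits (m + 1)) : inputBasis y ≠ B f y' := by
    intro h
    exact ht y (h ▸ Finset.mem_union_right _ (Finset.mem_insert_self _ _))
  have heq (f f' y y') : B f y = B f' y' ↔ f = f' ∧ y = y' := by
    refine ⟨fun h => ?_, fun ⟨h, h'⟩ => by rw [h, h']⟩
    have hf : f = f' := by rw [Bool.eq_iff_iff, ← hmem f y, ← hmem f' y', h]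
    subst hf
    refine ⟨rfl, inputBasis_injective ?_⟩
    have hi (y) : inputBasis y = (B f y).filter fun q => q ≠ outQubit ∧ q ≠ testQubit := by
      ext q
      have := h0 y
      have := ht y
      cases f <;> simp [hB] <;> grind
    rw [hi y, hi y', h]
  have hs (y : Fin 2 → Bits (m + 1)) : swapRows y 0 (Fin.last m) = y 0 (Fin.last m) :=
    snocBit_last _ _
  have hs' : x = swapRows y ↔ y = swapRows x :=
    ⟨fun h => by rw [h, swapRows_swapRows], fun h => by rw [h, swapRows_swapRows]⟩
  have hs'' : swapRows x = swapRows y ↔ y = x :=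
    ⟨fun h => by rw [← swapRows_swapRows x, h, swapRows_swapRows], fun h => by rw [h]⟩
  rw [run_swapTest, run_swapTest]
  change outForm ((1 / 2 : ℂ) • (_ + _ + (Finsupp.single (B _ _) 1 - Finsupp.single (B _ _) 1)))
    ((1 / 2 : ℂ) • (_ + _ + (Finsupp.single (B _ _) 1 - Finsupp.single (B _ _) 1))) = _
  simp only [outForm_smul_left, outForm_smul_right, outForm_add_left, outForm_add_right,
    outForm_sub_left, outForm_sub_right, outForm_single_single, h0, hmem, hne, (hne _ _ _).symm, heq,
    false_and, and_false, if_false, hs', hs'', eq_comm (a := swapRows x) (b := y),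
    eq_comm (a := x) (b := y)]
  by_cases hx : x 0 (Fin.last m) = true
  · have k1 : (x 0 (Fin.last m) = y 0 (Fin.last m) ∧ y = x) ↔ y = x :=
      and_iff_right_of_imp fun h => by rw [h]
    have k2 : (x 0 (Fin.last m) = y 0 (Fin.last m) ∧ y = swapRows x) ↔ y = swapRows x :=
      and_iff_right_of_imp fun h => by rw [h, hs]
    rw [hx] at k1 k2
    have hc : conj (1 / 2 : ℂ) = 1 / 2 := by simp [map_ofNat]
    simp only [k1, k2, hx, hc, true_and, if_true, map_one, mul_one]
    ring
  · simp [hx]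

/-- The identity `Tr(SWAP (σ ⊗ τ)) = Tr(σ τ)`, applied to the flag-`1` block of the first copy and
the flag-`g` block of the second. Flags are not swapped, so only diagonal flag blocks occur. -/
lemma acceptProb_swapTest {m : ℕ} (ρ : Matrix (Bits (m + 1)) (Bits (m + 1)) ℂ) :
    acceptProb (swapTest m) (tensorPow 2 ρ) = (1 / 2 * ∑ X : Bits m, ∑ Y : Bits m, ∑ g : Bool,
      (ρ (snocBit X true) (snocBit X true) * ρ (snocBit Y g) (snocBit Y g) -
        ρ (snocBit X true) (snocBit Y true) * ρ (snocBit Y g) (snocBit X g))).re := by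
  set G : Bits (m + 1) → Bits (m + 1) → ℂ := fun u v => if u (Fin.last m) = true then
    ρ u u * ρ v v - ρ u (snocBit (fun c => v c.castSucc) (u (Fin.last m))) *
      ρ v (snocBit (fun c => u c.castSucc) (v (Fin.last m))) else 0 with hG
  have h1 (x : Fin 2 → Bits (m + 1)) : ∑ y, tensorPow 2 ρ x y *
      outForm ((swapTest m).run (Finsupp.single (inputBasis x) 1))
        ((swapTest m).run (Finsupp.single (inputBasis y) 1)) = 1 / 2 * G (x 0) (x 1) := by
    simp only [outForm_swapTest, hG]
    by_cases hx : x 0 (Fin.last m) = true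
    · simp only [hx, if_true]
      have h2 (y : Fin 2 → Bits (m + 1)) : tensorPow 2 ρ x y *
          (1 / 2 * ((if y = x then 1 else 0) - (if y = swapRows x then 1 else 0))) =
          (1 / 2) * ((if y = x then tensorPow 2 ρ x y else 0) -
            (if y = swapRows x then tensorPow 2 ρ x y else 0)) := by
        split_ifs <;> ring
      simp_rw [h2, ← Finset.mul_sum, Finset.sum_sub_distrib, Finset.sum_ite_eq', Finset.mem_univ,
        if_true]
      simp [tensorPow, Fin.prod_univ_two, swapRows, hx]
    · simp [hx]
  rw [acceptProb_eq_outForm]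
  simp_rw [h1, ← Finset.mul_sum]
  congr 2
  have h3 : ∑ x : Fin 2 → Bits (m + 1), G (x 0) (x 1) = ∑ u, ∑ v, G u v := by
    rw [← Fintype.sum_prod_type']
    exact Fintype.sum_equiv (finTwoArrowEquiv _) _ _ fun x => rfl
  rw [h3, sum_snocBit _ true]
  have h4 : ∑ X : Bits m, ∑ v, G (snocBit X !true) v = 0 := by simp [hG]
  rw [h4, add_zero]
  refine Finset.sum_congr rfl fun X _ => ?_
  rw [sum_snocBit _ true, ← Finset.sum_add_distrib]
  refine Finset.sum_congr rfl fun Y _ => ?_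
  rw [Fintype.sum_bool]
  simp [hG]

lemma flagState_snocBit {m : ℕ} (b e : Bool) (ψ : PureState m) (X Y : Bits m) :
    flagState b ψ (snocBit X e) (snocBit Y e) =
      1 / 2 * (if e = b then ketbra ψ X Y else maxMixed m X Y) := by
  cases b <;> cases e <;> simp [flagState, flagged]

lemma sum_maxMixed_mul {m : ℕ} (M : Matrix (Bits m) (Bits m) ℂ) :
    ∑ X, ∑ Y, maxMixed m X Y * M Y X = M.trace / 2 ^ m := by
  simp [maxMixed, Matrix.one_apply, Matrix.trace, Finset.mul_sum, div_eq_inv_mul]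

lemma sum_ketbra_mul_ketbra {m : ℕ} (ψ : PureState m) :
    ∑ X, ∑ Y, ketbra ψ X Y * ketbra ψ Y X = 1 := by
  have h1 (X Y : Bits m) : ketbra ψ X Y * ketbra ψ Y X = ketbra ψ X X * ketbra ψ Y Y := by
    simp only [ketbra, Matrix.of_apply]
    ring
  simp_rw [h1, ← Finset.mul_sum, ← Finset.sum_mul]
  have htr : ∑ x : Bits m, ketbra ψ x x = 1 := trace_ketbra ψ
  rw [htr, one_mul]

/-- Each pair of flags has weight `1/4`. Under `rhoA` the first block is mixed and fails with
probability `(1 - 2^(-m)) / 2` against either second block. Under `rhoB` it is `ψ`, which fails with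
that probability against the mixed block and never against `ψ`. -/
lemma acceptProb_swapTest_sub {m : ℕ} (ψ : PureState m) :
    acceptProb (swapTest m) (tensorPow 2 (rhoA ψ)) - acceptProb (swapTest m) (tensorPow 2 (rhoB ψ)) =
      1 / 8 * (1 - 1 / 2 ^ m) := by
  have hk : ∑ x : Bits m, ketbra ψ x x = 1 := trace_ketbra ψ
  have hm : ∑ x : Bits m, maxMixed m x x = 1 := trace_maxMixed m
  have h1 := sum_ketbra_mul_ketbra ψ
  have h2 := sum_maxMixed_mul (ketbra ψ)
  have h3 := sum_maxMixed_mul (maxMixed m)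
  have h4 : ∑ X, ∑ Y, ketbra ψ X Y * maxMixed m Y X = 1 / 2 ^ m := by
    rw [Finset.sum_comm]
    simp_rw [mul_comm (ketbra ψ _ _)]
    rw [h2, trace_ketbra]
  have key (M N : Matrix (Bits m) (Bits m) ℂ) : ∑ X, ∑ Y, ((1 / 2 * M X X) * (1 / 2 * N Y Y) -
      (1 / 2 * M X Y) * (1 / 2 * N Y X)) =
      1 / 4 * ((∑ X, M X X) * (∑ Y, N Y Y) - ∑ X, ∑ Y, M X Y * N Y X) := by
    rw [Finset.sum_mul_sum, ← Finset.sum_sub_distrib, Finset.mul_sum]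
    refine Finset.sum_congr rfl fun X _ => ?_
    rw [← Finset.sum_sub_distrib, Finset.mul_sum]
    exact Finset.sum_congr rfl fun Y _ => by ring
  rw [trace_ketbra] at h2
  rw [trace_maxMixed] at h3
  rw [rhoA_eq_flagState, rhoB_eq_flagState, acceptProb_swapTest, acceptProb_swapTest,
    ← Complex.sub_re]
  simp only [flagState_snocBit, Fintype.sum_bool, Finset.sum_add_distrib, if_true,
    Bool.true_eq_false, Bool.false_eq_true, if_false, key, hk, hm, h1, h2, h3, h4]
  rw [← Complex.ofReal_re (1 / 8 * (1 - 1 / 2 ^ m))]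
  congr 1
  push_cast
  ring

/-- The program that writes `swapTest (n - 1)`. -/
def Prog.swapTest : Prog :=
  .seq (.dec 0) (.seq (.dec 1) (.seq (.emit (.H (2, 2, 2))) (.seq (.copy 4 0)
    (.seq (.countdown 4 (.emits [.CX (0, 1, 4) (0, 2, 4), .CCX (2, 2, 2) (0, 2, 4) (0, 1, 4),
      .CX (0, 1, 4) (0, 2, 4)])) (.emits [.H (2, 2, 2), .CCX (2, 2, 2) (0, 2, 0) (1, 2, 2)])))))

lemma isPolyTime_swapTest : IsPolyTime (fun _ => 2) fun n => swapTest (n - 1) := by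
  refine ⟨.swapTest, 6 * Polynomial.X + 20, fun n => ?_⟩
  -- After the two decrements cell `0` holds the flag column, cell `1` the row index `1` (from the
  -- two copies), and cell `2` serves as the constant `0`.
  set σ : Mem := fun i => if i = 0 then n - 1 else if i = 1 then 1 else 0 with hσ
  have e1 : Exec (.dec 0) (initMem n 2) [] (initMem (n - 1) 2) 1 := by
    convert Exec.dec 0 (initMem n 2) using 1
    ext i
    by_cases hi : i = 0 <;> simp [initMem, hi]
  have e2 : Exec (.dec 1) (initMem (n - 1) 2) [] σ 1 := by
    convert Exec.dec 1 (initMem (n - 1) 2) using 1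
    ext i
    by_cases hi : i = 0 <;> by_cases hi' : i = 1 <;> simp_all [initMem]
  have e3 := Exec.emit (.H (2, 2, 2)) σ
  have e4 : Exec (.copy 4 0) σ [] (Function.update σ 4 (n - 1)) 1 := by
    simpa [hσ] using Exec.copy 4 0 σ
  have e5 := Exec.countdown (i := 4) (σ := σ) (fun c => Exec.emits
    [.CX (0, 1, 4) (0, 2, 4), .CCX (2, 2, 2) (0, 2, 4) (0, 1, 4), .CX (0, 1, 4) (0, 2, 4)]
    (Function.update σ 4 c)) (n - 1)
  have e6 : Function.update σ 4 0 = σ := by simp [hσ]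
  rw [e6] at e5
  have e7 := Exec.emits [.H (2, 2, 2), .CCX (2, 2, 2) (0, 2, 0) (1, 2, 2)] σ
  have e := e1.seq (e2.seq (e3.seq (e4.seq (e5.seq e7))))
  refine ⟨σ, 1 + (1 + (1 + (1 + ((n - 1) * 6 + 1 + 3)))), ?_, ?_⟩
  · convert e using 1
    · rfl
    · simp [swapTest, swapColumns, Gate.map, Mem.qubit, hσ, testQubit, outQubit]
      rfl
    · rfl
  · simp
    omega

end SwapTest

theorem mainTheorem8 {K : ℕ → Type*} (D : ∀ m, PMF (K m)) (φ : ∀ m, K m → PureState m)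
    (hφ : IsPseudorandom D φ) :
    (∀ A : ConventionalAlgorithm, Negligible fun m =>
      |(∑' k, (D m k).toReal * A.prob (rhoA (φ m k))) -
        ∑' k, (D m k).toReal * A.prob (rhoB (φ m k))|) ∧
    (∃ (c : ℕ) (δ : ℝ) (C : ℕ → Circuit), 0 < δ ∧ IsPolyTime (fun _ => c) C ∧
      ∀ (m : ℕ), 1 ≤ m → ∀ ψ : PureState m,
        δ ≤ acceptProb (C (m + 1)) (tensorPow c (rhoA ψ)) -
          acceptProb (C (m + 1)) (tensorPow c (rhoB ψ))) := by
  -- `1 / 16` is the value of `1 / 8 * (1 - 1 / 2 ^ m)` at `m = 1`, where it is smallest.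
  refine ⟨fun A => ?_, 2, 1 / 16, fun n => swapTest (n - 1), by norm_num, isPolyTime_swapTest,
    fun m hm ψ => ?_⟩
  · obtain ⟨C, hC⟩ := A.exists_simulates false
    obtain ⟨C', hC'⟩ := A.exists_simulates true
    refine ((hC.negligible hφ).add (hC'.negligible hφ)).mono fun m => ?_
    rw [abs_sub_comm (∑' k, (D m k).toReal * A.prob (flagState true (φ m k)))]
    exact abs_sub_le _ _ _
  · simp only [Nat.add_sub_cancel]
    rw [acceptProb_swapTest_sub]
    have h1 : (2 : ℝ) ≤ 2 ^ m := le_self_pow₀ one_le_two (by omega)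
    have h2 : (1 : ℝ) / 2 ^ m ≤ 1 / 2 := one_div_le_one_div_of_le two_pos h1
    linarith
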